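/- Let $G$ be a finitely generated group, $u:G\to\mathbb{R}$ a nonzero homomorphism and $H$ a normal subgroup of finite index in $G$. Let $R=\mathbb{Z}[G/\ker u]$, a Noetherian unique factorization domain whose units are $\pm(G/\ker u)$. Let $G$ act on $R^{G/H}$ through left multiplication on $R$ and left translation on the index set $G/H$. This action commutes with the factorwise multiplication by $R$, so the homology group $H_1(G;R^{G/H})$ is an $R$-module. For a finitely generated $R$-module $M$ with a finite presentation $R^q\xrightarrow{\times A}R^p\to M\to 0$, $A\in \mathrm{M}_{q,p}(R)$, let $\mathrm{ord}_R(M)\in R$ be the greatest common divisor of the $p$-minors of $A$, which is defined up to units. The twisted Alexander polynomial is $$\Delta^H(G,u):=\mathrm{ord}_R\big(H_1(G;R^{G/H})\big)\in R\ \text{ modulo units}.$$ It is called $u$-monic if its $u$-minimal part is $\pm g$ for some $g\in G/\ker u$, i.e. if the coefficient of $g$ is $\pm1$ and $\overline u(h)>\overline u(g)$ for every other $h$ in the support, where $\overline u$ is the homomorphism $G/\ker u\to\mathbb{R}$ induced by $u$. Write $\overline u$ also for the homomorphism $G/(H\cap\ker u)\to\mathbb{R}$ induced by $u$, and let $\mathbb{Z}[G/(H\cap\ker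 u)]_{\overline u}$ be the Novikov ring of formal integral series $\lambda$ over $G/(H\cap\ker u)$ such that $\mathrm{supp}(\lambda)\cap\{\overline u\le C\}$ is finite for every $C\in\mathbb{R}$; it is a left $\mathbb{Z}[G]$-module by left multiplication. The Abelianized relative Novikov homology is $$H_1^{ab}(G,H,u):=H_1\big(G;\mathbb{Z}[G/(H\cap\ker u)]_{\overline u}\big).$$ Then the twisted Alexander polynomial $\Delta^H(G,u)$ exists (that is, $H_1(G;R^{G/H})$ has a finite presentation over $R$ whose $p$-minors have a greatest common divisor), and $$\Delta^H(G,u)\ \text{is $u$-monic}\iff H_1^{ab}(G,H,u)=0.$$ -/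

import Mathlib

noncomputable section

namespace TwistedAlexander

/-! Homomorphisms to the additive group of real numbers are written `u : G →* Multiplicative ℝ`,
so that `u.ker` is a subgroup of `G`; the real number `u(g)` is `(u g).toAdd`. -/

/-! ### Order of a finitely generated module -/

/-- The ideal generated by the `p`-minors of a `q × p` matrix (the determinants of the square
matrices formed by `p` of its rows). It is `0` if `q < p`, and the unit ideal if `p = 0`. -/
def minorIdeal {R : Type*} [CommRing R] {p q : ℕ} (A : Matrix (Fin q) (Fin p) R) : Ideal R :=
  Ideal.span (Set.range fun e : Fin p ↪o Fin q => (A.submatrix e id).det)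

/-- `R^q --(× A)--> R^p --π--> M → 0` is a presentation of `M`; elements of `R^q` and `R^p` are row
vectors, and `× A` is right multiplication by `A`. -/
def IsMatrixPresentation {R : Type*} [CommRing R] {M : Type*} [AddCommGroup M] [Module R M]
    {p q : ℕ} (A : Matrix (Fin q) (Fin p) R) (π : (Fin p → R) →ₗ[R] M) : Prop :=
  Function.Surjective π ∧ LinearMap.ker π = LinearMap.range A.vecMulLinear

/-- `d` is a greatest common divisor of the elements of the ideal `I`. -/
def IsGcdOfIdeal {R : Type*} [CommRing R] (I : Ideal R) (d : R) : Prop :=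
  ∀ a : R, a ∣ d ↔ ∀ x ∈ I, a ∣ x

/-- `d` is (a representative, up to units, of) the order `ord_R(M)`: a greatest common divisor of
the Fitting ideal of order `0`, computed from a finite presentation of `M`. -/
def IsOrder (R : Type*) [CommRing R] (M : Type*) [AddCommGroup M] [Module R M] (d : R) : Prop :=
  ∃ (p q : ℕ) (A : Matrix (Fin q) (Fin p) R) (π : (Fin p → R) →ₗ[R] M),
    IsMatrixPresentation A π ∧ IsGcdOfIdeal (minorIdeal A) d

variable {G : Type} [Group G]

/-! ### Twisted Alexander polynomials -/

/-- `G / ker u` is commutative, being isomorphic to a group of real numbers. -/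
instance quotientKerCommGroup (u : G →* Multiplicative ℝ) : CommGroup (G ⧸ u.ker) :=
  { (inferInstance : Group (G ⧸ u.ker)) with
    mul_comm := fun a b => QuotientGroup.kerLift_injective u (by
      rw [map_mul, map_mul, mul_comm]) }

/-- The commutative ring `ℤ[G / ker u]`. -/
abbrev QuotientRing (u : G →* Multiplicative ℝ) : Type := MonoidAlgebra ℤ (G ⧸ u.ker)

/-- The `G`-module `ℤ[G / ker u]^(G/H)`, with `G` acting both on `ℤ[G / ker u]` (by left
multiplication) and on the index set `G/H`. The action is `ℤ[G / ker u]`-linear for the module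
structure in which `ℤ[G / ker u]` multiplies every factor and does not permute the factors. -/
def alexanderRep (H : Subgroup G) (u : G →* Multiplicative ℝ) :
    Representation (QuotientRing u) G (G ⧸ H → QuotientRing u) where
  toFun g :=
    { toFun := fun f x => MonoidAlgebra.single (g : G ⧸ u.ker) (1 : ℤ) * f (g⁻¹ • x)
      map_add' := fun f f' => by
        funext x
        simp [mul_add]
      map_smul' := fun r f => by
        funext x
        simp [mul_left_comm] }
  map_one' := by
    refine LinearMap.ext fun f => funext fun x => ?_
    simp [← MonoidAlgebra.one_def]
  map_mul' g h := by
    refine LinearMap.ext fun f => funext fun x => ?_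
    simp [← mul_assoc, MonoidAlgebra.single_mul_single, mul_smul]

/-- `H₁(G; ℤ[G / ker u]^(G/H))`, as a module over `ℤ[G / ker u]`. -/
abbrev alexanderModule (H : Subgroup G) (u : G →* Multiplicative ℝ) :
    ModuleCat (QuotientRing u) :=
  groupHomology (Rep.of (alexanderRep H u)) 1

/-- `Δ` represents the twisted Alexander polynomial `Δ^H(G,u)`, which is an element of
`ℤ[G / ker u]` defined up to units. -/
def IsTwistedAlexanderPolynomial (H : Subgroup G) (u : G →* Multiplicative ℝ)
    (Δ : QuotientRing u) : Prop :=
  IsOrder (QuotientRing u) (alexanderModule H u) Δ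

/-- An element of `ℤ[Q]` is `v`-monic if its `v`-minimal part is `± g` for some `g` in `Q`. -/
def IsMonic {Q : Type*} [Group Q] (v : Q →* Multiplicative ℝ) (a : MonoidAlgebra ℤ Q) : Prop :=
  ∃ g : Q, (a.coeff g = 1 ∨ a.coeff g = -1) ∧ ∀ h : Q, h ≠ g → a.coeff h ≠ 0 →
    (v g).toAdd < (v h).toAdd

/-! ### Novikov homology -/

/-- The additive group of the Novikov ring `ℤ[Q]_v`: the formal series `∑ a_g g` with integer
coefficients such that, for every real `C`, only finitely many elements `g` of the support
satisfy `v(g) ≤ C`. -/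
def novikov {Q : Type*} [Group Q] (v : Q →* Multiplicative ℝ) : Submodule ℤ (Q → ℤ) where
  carrier := {a | ∀ C : ℝ, {g : Q | a g ≠ 0 ∧ (v g).toAdd ≤ C}.Finite}
  zero_mem' C := by simp
  add_mem' := by
    intro a b ha hb C
    refine ((ha C).union (hb C)).subset ?_
    rintro g ⟨hg, hC⟩
    by_cases h : a g = 0
    · exact Or.inr ⟨fun h' => hg (by simp [h, h']), hC⟩
    · exact Or.inl ⟨h, hC⟩
  smul_mem' := by
    intro n a ha C
    refine (ha C).subset ?_
    rintro g ⟨hg, hC⟩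
    exact ⟨fun h => hg (by simp [h]), hC⟩

/-- Left multiplication by elements of `Q` on the Novikov ring `ℤ[Q]_v`:
the coefficient of `x` in `g * a` is the coefficient of `g⁻¹ * x` in `a`. -/
def novikovRep {Q : Type*} [Group Q] (v : Q →* Multiplicative ℝ) :
    Representation ℤ Q (novikov v) where
  toFun g :=
    { toFun := fun a => ⟨fun x => a.1 (g⁻¹ * x), fun C => by
        refine ((a.2 (C - (v g).toAdd)).image (fun x => g * x)).subset ?_
        rintro x ⟨hx, hC⟩
        refine ⟨g⁻¹ * x, ⟨hx, ?_⟩, by simp⟩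
        simp only [map_mul, map_inv, toAdd_mul, toAdd_inv]
        linarith⟩
      map_add' := fun a b => rfl
      map_smul' := fun n a => rfl }
  map_one' := by
    refine LinearMap.ext fun a => Subtype.ext (funext fun x => ?_)
    simp
  map_mul' g h := by
    refine LinearMap.ext fun a => Subtype.ext (funext fun x => ?_)
    simp [mul_assoc]

/-- The homomorphism `ū : G / (H ∩ ker u) → ℝ` induced by `u`. -/
def inducedHom (H : Subgroup G) [H.Normal] (u : G →* Multiplicative ℝ) :
    G ⧸ (H ⊓ u.ker) →* Multiplicative ℝ :=
  QuotientGroup.lift (H ⊓ u.ker) u fun _ hx => hx.2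

/-- The Abelianized relative Novikov homology `H₁^{ab}(G,H,u) = H₁(G; ℤ[G / (H ∩ ker u)]_ū)`, the
coefficients being a left `G`-module through the projection `G → G / (H ∩ ker u)`. -/
abbrev abelianizedNovikovHomology (H : Subgroup G) [H.Normal] (u : G →* Multiplicative ℝ) :
    ModuleCat ℤ :=
  groupHomology (Rep.of ((novikovRep (inducedHom H u)).comp (QuotientGroup.mk' (H ⊓ u.ker)))) 1

/-!
Write `A = G / ker u` and `R = ℤ[A]`, and let `R̂` be the Novikov completion of `R`.

As a set with `G`-action, `A × G/H` is a disjoint union of finitely many copies of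
`G / (H ∩ ker u)`, so `R̂^(G/H)` is a finite direct sum of copies of the Novikov ring of
`G / (H ∩ ker u)`. Hence `H₁^{ab}(G, H, u)` vanishes if and only if `H₁(G; R̂^(G/H))` does.

The latter vanishes if and only if some monic element of `R` annihilates `H₁(G; R^(G/H))`. One
implication holds because monic elements act invertibly on `R̂`. For the other, truncating the
`2`-chains over `R̂` that bound finitely many cycles over `R` shows that, modulo boundaries, these
cycles are combinations of given generators with coefficients supported on `v > 0`; Nakayama's
lemma over the subring of elements supported on `v ≥ 0` then produces a monic annihilator.

The Fitting ideal of a module and its annihilator have the same radical, so it remains to see that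
a greatest common divisor of an ideal of `R` is monic if and only if the ideal contains a monic
element. If it does not, it lies in a prime ideal `P` without monic elements, as these form a
multiplicative set, and it suffices that `P` is principal. If `P` contains a prime number `p`, then
`P = (p)`. Otherwise the residue field of `P` carries a valuation that is less than `1` on the
elements of `A` with `v > 0`, hence is injective on `A`; as it takes only powers of one value on the
integers, some group ring of a hyperplane of `A` embeds into the residue field, which forces `P` to
have height at most one.
-/

/-! ### First homology in terms of inhomogeneous chains -/

section Chains

open groupHomology

universe w

variable {k G V : Type w} [CommRing k] [Group G] [AddCommGroup V] [Module k V]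

/-- The differential from inhomogeneous `1`-chains to `0`-chains, for an unbundled
representation. -/
def diffOne (ρ : Representation k G V) : (G →₀ V) →ₗ[k] V :=
  (d₁₀ (Rep.of ρ)).hom

/-- The differential from inhomogeneous `2`-chains to `1`-chains, for an unbundled
representation. -/
def diffTwo (ρ : Representation k G V) : (G × G →₀ V) →ₗ[k] (G →₀ V) :=
  (d₂₁ (Rep.of ρ)).hom

/-- The inhomogeneous `1`-cycles. -/
def cycles (ρ : Representation k G V) : Submodule k (G →₀ V) := LinearMap.ker (diffOne ρ)

/-- The inhomogeneous `1`-boundaries. -/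
def boundaries (ρ : Representation k G V) : Submodule k (G →₀ V) := LinearMap.range (diffTwo ρ)

@[simp]
lemma diffOne_single (ρ : Representation k G V) (g : G) (v : V) :
    diffOne ρ (Finsupp.single g v) = ρ g⁻¹ v - v :=
  d₁₀_single (Rep.of ρ) g v

@[simp]
lemma diffTwo_single (ρ : Representation k G V) (g : G × G) (v : V) :
    diffTwo ρ (Finsupp.single g v) =
      Finsupp.single g.2 (ρ g.1⁻¹ v) - Finsupp.single (g.1 * g.2) v + Finsupp.single g.1 v :=
  d₂₁_single (A := Rep.of ρ) g v

lemma mem_cycles {ρ : Representation k G V} {z : G →₀ V} : z ∈ cycles ρ ↔ diffOne ρ z = 0 :=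
  LinearMap.mem_ker

lemma boundaries_le_cycles (ρ : Representation k G V) : boundaries ρ ≤ cycles ρ :=
  boundaries₁_le_cycles₁ (Rep.of ρ)

/-- First homology as the quotient of the cycles by the boundaries. -/
def homologyOneEquiv (ρ : Representation k G V) :
    (cycles ρ ⧸ (boundaries ρ).comap (cycles ρ).subtype) ≃ₗ[k] groupHomology (Rep.of ρ) 1 :=
  (Submodule.quotEquivOfEq _ _ (by
    ext z
    exact (H1π_eq_zero_iff (A := Rep.of ρ) z).symm)).trans
  ((H1π (Rep.of ρ)).hom.quotKerEquivOfSurjective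
    ((ModuleCat.epi_iff_surjective _).1 inferInstance))

lemma subsingleton_homologyOne_iff (ρ : Representation k G V) :
    Subsingleton (groupHomology (Rep.of ρ) 1) ↔ cycles ρ ≤ boundaries ρ := by
  rw [← (homologyOneEquiv ρ).toEquiv.subsingleton_congr, Submodule.Quotient.subsingleton_iff,
    Submodule.comap_subtype_eq_top]

lemma mem_annihilator_homologyOne_iff (ρ : Representation k G V) (s : k) :
    s ∈ Module.annihilator k (groupHomology (Rep.of ρ) 1) ↔
      ∀ z ∈ cycles ρ, s • z ∈ boundaries ρ := by
  rw [← (homologyOneEquiv ρ).annihilator_eq, Submodule.annihilator_quotient, Submodule.mem_colon]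
  exact ⟨fun h z hz => h ⟨z, hz⟩ trivial, fun h z _ => h z z.2⟩

section Naturality

variable {k' V' : Type w} [CommRing k'] [AddCommGroup V'] [Module k' V']
  {ρ : Representation k G V} {ρ' : Representation k' G V'} (f : V →+ V')

lemma diffOne_mapRange (hf : ∀ g v, f (ρ g v) = ρ' g (f v)) (z : G →₀ V) :
    diffOne ρ' (Finsupp.mapRange.addMonoidHom f z) = f (diffOne ρ z) := by
  induction z using Finsupp.induction_linear with
  | zero => simp
  | add a b ha hb => simp only [map_add, ha, hb]
  | single g v => simp [hf]

lemma diffTwo_mapRange (hf : ∀ g v, f (ρ g v) = ρ' g (f v)) (w : G × G →₀ V) :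
    diffTwo ρ' (Finsupp.mapRange.addMonoidHom f w) =
      Finsupp.mapRange.addMonoidHom f (diffTwo ρ w) := by
  induction w using Finsupp.induction_linear with
  | zero => simp
  | add a b ha hb => simp only [map_add, ha, hb]
  | single g v =>
    simp only [diffTwo_single, map_add, map_sub, Finsupp.mapRange.addMonoidHom_apply,
      Finsupp.mapRange_single, hf]

lemma mapRange_mem_cycles (hf : ∀ g v, f (ρ g v) = ρ' g (f v)) {z : G →₀ V}
    (hz : z ∈ cycles ρ) : Finsupp.mapRange.addMonoidHom f z ∈ cycles ρ' := by
  rw [mem_cycles, diffOne_mapRange f hf, mem_cycles.1 hz, map_zero]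

lemma mapRange_mem_boundaries (hf : ∀ g v, f (ρ g v) = ρ' g (f v)) {z : G →₀ V}
    (hz : z ∈ boundaries ρ) : Finsupp.mapRange.addMonoidHom f z ∈ boundaries ρ' := by
  obtain ⟨w, rfl⟩ := hz
  exact ⟨_, diffTwo_mapRange f hf w⟩

end Naturality

lemma single_mem_of_mem_closure {ρ : Representation k G V} {N : Submodule k (G →₀ V)}
    (hN : boundaries ρ ≤ N) {S : Set G} (hS : ∀ g ∈ S, ∀ v, Finsupp.single g v ∈ N) {g : G}
    (hg : g ∈ Subgroup.closure S) (v : V) : Finsupp.single g v ∈ N := by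
  have hmul (g h : G) (v : V) : Finsupp.single h (ρ g⁻¹ v) - Finsupp.single (g * h) v +
      Finsupp.single g v ∈ N := by
    rw [← diffTwo_single ρ (g, h) v]
    exact hN ⟨_, rfl⟩
  have hone (v : V) : Finsupp.single 1 v ∈ N := by simpa using hmul 1 1 v
  induction hg using Subgroup.closure_induction generalizing v with
  | mem g hg => exact hS g hg v
  | one => exact hone v
  | mul g h _ _ ihg ihh =>
    have := (N.add_mem_iff_left (ihg v)).1 (hmul g h v)
    exact (N.sub_mem_iff_right (ihh _)).1 this
  | inv g _ ih =>
    have := (N.add_mem_iff_left (ih _)).1 (hmul g g⁻¹ (ρ g v))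
    rw [mul_inv_cancel, Representation.inv_self_apply] at this
    exact (N.sub_mem_iff_left (hone _)).1 this

lemma finite_chains_quotient_boundaries [Group.FG G] (ρ : Representation k G V)
    [Module.Finite k V] : Module.Finite k ((G →₀ V) ⧸ boundaries ρ) := by
  obtain ⟨S, hS⟩ := Group.FG.out (G := G)
  let N : Submodule k (G →₀ V) := ⨆ g : S, LinearMap.range (Finsupp.lsingle (g : G))
  have hNS (g : G) (hg : g ∈ S) (v : V) : Finsupp.single g v ∈ N ⊔ boundaries ρ :=
    Submodule.mem_sup_left (Submodule.mem_iSup_of_mem (⟨g, hg⟩ : S) ⟨v, rfl⟩)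
  have hNtop : N ⊔ boundaries ρ = ⊤ := by
    refine Submodule.eq_top_iff'.2 fun z => ?_
    induction z using Finsupp.induction_linear with
    | zero => exact zero_mem _
    | add a b ha hb => exact add_mem ha hb
    | single g v =>
      exact single_mem_of_mem_closure le_sup_right hNS (hS ▸ Subgroup.mem_top g) v
  have hNfg : N.FG := Submodule.fg_iSup _ fun g => by
    rw [LinearMap.range_eq_map]
    exact Module.Finite.fg_top.map _
  refine ⟨?_⟩
  rw [← Submodule.range_mkQ, LinearMap.range_eq_map, ← hNtop, Submodule.map_sup,
    Submodule.mkQ_map_self, sup_bot_eq]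
  exact hNfg.map _

lemma finite_homologyOne [IsNoetherianRing k] [Group.FG G] (ρ : Representation k G V)
    [Module.Finite k V] : Module.Finite k (groupHomology (Rep.of ρ) 1) := by
  have := finite_chains_quotient_boundaries ρ
  have hinj : Function.Injective (((boundaries ρ).comap (cycles ρ).subtype).mapQ (boundaries ρ)
      (cycles ρ).subtype le_rfl) :=
    LinearMap.ker_eq_bot.1 (Submodule.ker_liftQ_eq_bot _ _ _ (by simp [LinearMap.ker_comp]))
  have := Module.Finite.of_injective _ hinj
  exact Module.Finite.equiv (homologyOneEquiv ρ)

end Chains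

/-! ### Initial terms in group rings -/

section InitialTerms

variable {k A : Type*}

lemma eq_of_coeff_single_ne_zero [Semiring k] {a g : A} {c : k}
    (hg : (MonoidAlgebra.single a c).coeff g ≠ 0) : g = a := by
  by_contra hne
  exact hg (by simp [hne])

variable [Group A] {v : A →* Multiplicative ℝ}

section Semiring

variable [Semiring k]

variable (v) in
/-- `g` is the `v`-minimal element of the support of `a`; the `v`-minimal part of `a` is then its
term at `g`. -/
def IsInitial (a : MonoidAlgebra k A) (g : A) : Prop :=
  a.coeff g ≠ 0 ∧ ∀ h, h ≠ g → a.coeff h ≠ 0 → (v g).toAdd < (v h).toAdd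

lemma IsInitial.le {a : MonoidAlgebra k A} {g h : A} (hg : IsInitial v a g)
    (hh : a.coeff h ≠ 0) : (v g).toAdd ≤ (v h).toAdd := by
  rcases eq_or_ne h g with rfl | hne
  · exact le_rfl
  · exact (hg.2 h hne hh).le

lemma IsInitial.eq {a : MonoidAlgebra k A} {g h : A} (hg : IsInitial v a g)
    (hh : IsInitial v a h) : g = h := by
  by_contra hne
  exact lt_asymm (hg.2 h (Ne.symm hne) hh.1) (hh.2 g hne hg.1)

lemma isInitial_of_forall_le (hv : Function.Injective v) {a : MonoidAlgebra k A} {g : A}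
    (hg : a.coeff g ≠ 0) (hle : ∀ h, a.coeff h ≠ 0 → (v g).toAdd ≤ (v h).toAdd) :
    IsInitial v a g :=
  ⟨hg, fun h hne hh => lt_of_le_of_ne (hle h hh) fun e =>
    hne (hv (Multiplicative.toAdd.injective e)).symm⟩

lemma exists_isInitial (hv : Function.Injective v) {a : MonoidAlgebra k A} (ha : a ≠ 0) :
    ∃ g, IsInitial v a g := by
  obtain ⟨g, hg, hmin⟩ := Finset.exists_min_image a.coeff.support (fun g => (v g).toAdd)
    (Finsupp.support_nonempty_iff.2 (by simpa using ha))
  exact ⟨g, isInitial_of_forall_le hv (by simpa using hg) fun h hh => hmin h (by simpa using hh)⟩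

lemma exists_mul_eq_of_coeff_mul_ne_zero {a b : MonoidAlgebra k A} {x : A}
    (hx : (a * b).coeff x ≠ 0) : ∃ g h, a.coeff g ≠ 0 ∧ b.coeff h ≠ 0 ∧ g * h = x := by
  classical
  have := MonoidAlgebra.support_coeff_mul_subset a b (Finsupp.mem_support_iff.2 hx)
  obtain ⟨g, hg, h, hh, e⟩ := Finset.mem_mul.1 this
  exact ⟨g, h, by simpa using hg, by simpa using hh, e⟩

lemma coeff_mul_of_forall_le (hv : Function.Injective v) {a b : MonoidAlgebra k A} {g h : A}
    (ha : ∀ x, a.coeff x ≠ 0 → (v g).toAdd ≤ (v x).toAdd)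
    (hb : ∀ x, b.coeff x ≠ 0 → (v h).toAdd ≤ (v x).toAdd) :
    (a * b).coeff (g * h) = a.coeff g * b.coeff h := by
  refine MonoidAlgebra.coeff_mul_mul_of_uniqueMul fun x y hx hy hxy => ?_
  have hgx := ha x (by simpa using hx)
  have hhy := hb y (by simpa using hy)
  have hsum := congrArg (fun z => (v z).toAdd) hxy
  simp only [map_mul, toAdd_mul] at hsum
  constructor <;> refine hv (Multiplicative.toAdd.injective ?_) <;> linarith

lemma IsInitial.coeff_mul (hv : Function.Injective v) {a b : MonoidAlgebra k A} {g h : A}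
    (ha : IsInitial v a g) (hb : IsInitial v b h) :
    (a * b).coeff (g * h) = a.coeff g * b.coeff h :=
  coeff_mul_of_forall_le hv (fun _ => ha.le) (fun _ => hb.le)

lemma IsInitial.mul [NoZeroDivisors k] (hv : Function.Injective v) {a b : MonoidAlgebra k A}
    {g h : A} (ha : IsInitial v a g) (hb : IsInitial v b h) : IsInitial v (a * b) (g * h) := by
  refine isInitial_of_forall_le hv ?_ fun x hx => ?_
  · rw [ha.coeff_mul hv hb]
    exact mul_ne_zero ha.1 hb.1
  · obtain ⟨y, z, hy, hz, rfl⟩ := exists_mul_eq_of_coeff_mul_ne_zero hx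
    simp only [map_mul, toAdd_mul]
    exact add_le_add (ha.le hy) (hb.le hz)

end Semiring

lemma isMonic_iff_exists_isInitial {a : MonoidAlgebra ℤ A} :
    IsMonic v a ↔ ∃ g, IsInitial v a g ∧ IsUnit (a.coeff g) := by
  constructor
  · rintro ⟨g, hg, hlt⟩
    have hunit := Int.isUnit_iff.2 hg
    exact ⟨g, ⟨hunit.ne_zero, hlt⟩, hunit⟩
  · rintro ⟨g, hg, hunit⟩
    exact ⟨g, Int.isUnit_iff.1 hunit, hg.2⟩

lemma isMonic_mul_iff (hv : Function.Injective v) {a b : MonoidAlgebra ℤ A} :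
    IsMonic v (a * b) ↔ IsMonic v a ∧ IsMonic v b := by
  simp only [isMonic_iff_exists_isInitial]
  constructor
  · rintro ⟨x, hx, hunit⟩
    have hab : a * b ≠ 0 := fun e => hx.1 (by simp [e])
    obtain ⟨g, hg⟩ := exists_isInitial hv (left_ne_zero_of_mul hab)
    obtain ⟨h, hh⟩ := exists_isInitial hv (right_ne_zero_of_mul hab)
    obtain rfl := (hg.mul hv hh).eq hx
    rw [hg.coeff_mul hv hh, IsUnit.mul_iff] at hunit
    exact ⟨⟨g, hg, hunit.1⟩, ⟨h, hh, hunit.2⟩⟩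
  · rintro ⟨⟨g, hg, hgu⟩, ⟨h, hh, hhu⟩⟩
    exact ⟨g * h, hg.mul hv hh, by rw [hg.coeff_mul hv hh]; exact hgu.mul hhu⟩

lemma isMonic_one : IsMonic v (1 : MonoidAlgebra ℤ A) :=
  ⟨1, Or.inl (by simp), fun _ hne hh => absurd (eq_of_coeff_single_ne_zero hh) hne⟩

/-- The multiplicative set of monic elements. -/
def monicSubmonoid (hv : Function.Injective v) : Submonoid (MonoidAlgebra ℤ A) where
  carrier := {a | IsMonic v a}
  one_mem' := isMonic_one
  mul_mem' ha hb := (isMonic_mul_iff hv).2 ⟨ha, hb⟩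

section NonnegSubring

variable [Ring k]

variable (k v) in
/-- The subring of the group ring formed by the elements supported on `v ≥ 0`. -/
def nonnegSubring : Subring (MonoidAlgebra k A) where
  carrier := {a | ∀ g, a.coeff g ≠ 0 → 0 ≤ (v g).toAdd}
  zero_mem' g := by simp
  one_mem' g hg := by simp [eq_of_coeff_single_ne_zero hg]
  add_mem' {a b} ha hb g hg := by
    by_cases h : a.coeff g = 0
    · exact hb g fun h' => hg (by simp [h, h'])
    · exact ha g h
  neg_mem' {a} ha g hg := ha g (by simpa using hg)
  mul_mem' {a b} ha hb g hg := by
    obtain ⟨y, z, hy, hz, rfl⟩ := exists_mul_eq_of_coeff_mul_ne_zero hg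
    simp only [map_mul, toAdd_mul]
    exact add_nonneg (ha y hy) (hb z hz)

lemma single_mem_nonnegSubring {a : A} (ha : 0 ≤ (v a).toAdd) (c : k) :
    MonoidAlgebra.single a c ∈ nonnegSubring k v :=
  fun g hg => by rwa [eq_of_coeff_single_ne_zero hg]

/-- The coefficient of `1`, which is multiplicative on the elements supported on `v ≥ 0`. -/
def constCoeff (hv : Function.Injective v) : nonnegSubring k v →+* k where
  toFun a := a.1.coeff 1
  map_one' := by simp
  map_zero' := by simp
  map_add' a b := by simp
  map_mul' a b := by
    simpa using coeff_mul_of_forall_le hv (a := a.1) (b := b.1) (g := 1) (h := 1)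
      (fun x hx => by simpa using a.2 x hx) (fun x hx => by simpa using b.2 x hx)

lemma constCoeff_eq_zero (hv : Function.Injective v) {a : nonnegSubring k v}
    (ha : ∀ g, a.1.coeff g ≠ 0 → 0 < (v g).toAdd) : constCoeff hv a = 0 := by
  by_contra h
  simpa using ha 1 h

lemma constCoeff_single_of_pos (hv : Function.Injective v) {a : A} (ha : 0 < (v a).toAdd) (c : k) :
    constCoeff hv ⟨MonoidAlgebra.single a c, single_mem_nonnegSubring ha.le c⟩ = 0 :=
  constCoeff_eq_zero hv fun g hg => by rwa [eq_of_coeff_single_ne_zero hg]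

end NonnegSubring

lemma isMonic_of_isUnit_constCoeff (hv : Function.Injective v) (a : nonnegSubring ℤ v)
    (ha : IsUnit (constCoeff hv a)) : IsMonic v a.1 :=
  isMonic_iff_exists_isInitial.2 ⟨1, isInitial_of_forall_le hv ha.ne_zero
    fun h hh => by simpa using a.2 h hh, ha⟩

end InitialTerms

/-! ### Fitting ideals and greatest common divisors -/

section Fitting

variable {R : Type*} [CommRing R] {p q : ℕ}

lemma det_submatrix_mem_minorIdeal (A : Matrix (Fin q) (Fin p) R) (f : Fin p → Fin q) :
    (A.submatrix f id).det ∈ minorIdeal A := by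
  by_cases hf : Function.Injective f
  · let e : Fin p ↪o Fin q := (Finset.univ.map ⟨f, hf⟩).orderEmbOfFin (by simp)
    have hfe (i : Fin p) : f i ∈ Set.range e := by simp [e]
    choose σ hσ using hfe
    have hσ_inj : Function.Injective σ := fun i j h => hf (by rw [← hσ, ← hσ, h])
    let τ : Equiv.Perm (Fin p) := Equiv.ofBijective σ (Finite.injective_iff_bijective.1 hσ_inj)
    have hperm : A.submatrix f id = (A.submatrix e id).submatrix τ id := by
      ext i j
      simp [τ, hσ]
    rw [hperm, Matrix.det_permute]
    exact Ideal.mul_mem_left _ _ (Ideal.subset_span ⟨e, rfl⟩)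
  · obtain ⟨i, j, hij, hne⟩ := Function.not_injective_iff.1 hf
    rw [Matrix.det_zero_of_row_eq hne (by ext l; simp [hij])]
    exact zero_mem _

lemma det_mul_mem_minorIdeal (B : Matrix (Fin p) (Fin q) R) (A : Matrix (Fin q) (Fin p) R) :
    (B * A).det ∈ minorIdeal A := by
  -- expand the determinant multilinearly in the rows of `B * A`, as in the Cauchy–Binet formula
  let D := (Matrix.detRowAlternating (n := Fin p) (R := R)).toMultilinearMap
  have hrows : B * A = fun i => ∑ j, B i j • A j := by
    ext i l
    simp [Matrix.mul_apply]
  change D (B * A) ∈ _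
  rw [hrows, D.map_sum (fun i j => B i j • A j)]
  refine Ideal.sum_mem _ fun f _ => ?_
  rw [MultilinearMap.map_smul_univ]
  exact Ideal.mul_mem_left _ _ (det_submatrix_mem_minorIdeal A f)

variable {M : Type*} [AddCommGroup M] [Module R M] {A : Matrix (Fin q) (Fin p) R}
  {π : (Fin p → R) →ₗ[R] M}

lemma IsMatrixPresentation.minorIdeal_le_annihilator (h : IsMatrixPresentation A π) :
    minorIdeal A ≤ Module.annihilator R M := by
  refine Ideal.span_le.2 ?_
  rintro _ ⟨e, rfl⟩
  refine Module.mem_annihilator.2 fun m => ?_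
  obtain ⟨x, rfl⟩ := h.1 m
  rw [← map_smul, ← LinearMap.mem_ker, h.2]
  have hrows : (1 : Matrix (Fin q) (Fin q) R).submatrix e id * A = A.submatrix e id :=
    Matrix.one_submatrix_mul e (Equiv.refl _) A
  refine ⟨Matrix.vecMul x
    ((A.submatrix e id).adjugate * (1 : Matrix (Fin q) (Fin q) R).submatrix e id), ?_⟩
  rw [Matrix.vecMulLinear_apply, Matrix.vecMul_vecMul, Matrix.mul_assoc, hrows,
    Matrix.adjugate_mul, Matrix.vecMul_smul, Matrix.vecMul_one]

lemma IsMatrixPresentation.pow_mem_minorIdeal (h : IsMatrixPresentation A π) {s : R}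
    (hs : s ∈ Module.annihilator R M) : s ^ p ∈ minorIdeal A := by
  have hrow (i : Fin p) : ∃ b, Matrix.vecMul b A = s • Pi.single i (1 : R) := by
    have : s • Pi.single i (1 : R) ∈ LinearMap.ker π := by
      rw [LinearMap.mem_ker, map_smul, Module.mem_annihilator.1 hs]
    rw [h.2] at this
    exact this
  choose B hB using hrow
  have hBA : Matrix.of B * A = s • (1 : Matrix (Fin p) (Fin p) R) := by
    ext i j
    rw [Matrix.smul_apply, Matrix.one_eq_pi_single]
    exact congrFun (hB i) j
  simpa [hBA, Matrix.det_smul] using det_mul_mem_minorIdeal (Matrix.of B) A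

lemma exists_isMatrixPresentation [IsNoetherianRing R] [Module.Finite R M] :
    ∃ (p q : ℕ) (A : Matrix (Fin q) (Fin p) R) (π : (Fin p → R) →ₗ[R] M),
      IsMatrixPresentation A π := by
  obtain ⟨p, π, hπ⟩ := Module.Finite.exists_fin' R M
  obtain ⟨q, s, hs⟩ := Submodule.fg_iff_exists_fin_generating_family.1
    (IsNoetherian.noetherian (LinearMap.ker π))
  refine ⟨p, q, Matrix.of s, π, hπ, ?_⟩
  rw [← hs, range_vecMulLinear]
  rfl

lemma exists_isGcdOfIdeal [UniqueFactorizationMonoid R] [IsNoetherianRing R]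
    (I : Ideal R) : ∃ d, IsGcdOfIdeal I d := by
  classical
  let _ := UniqueFactorizationMonoid.strongNormalizationMonoid (α := R)
  let _ := UniqueFactorizationMonoid.toNormalizedGCDMonoid R
  obtain ⟨s, rfl⟩ := IsNoetherian.noetherian I
  refine ⟨s.gcd id, fun a => ?_⟩
  rw [Finset.dvd_gcd_iff]
  simp only [id_eq, ← Ideal.mem_span_singleton]
  exact (Ideal.span_le (I := Ideal.span {a})).symm

lemma exists_isOrder [UniqueFactorizationMonoid R] [IsNoetherianRing R]
    [Module.Finite R M] : ∃ d, IsOrder R M d := by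
  obtain ⟨p, q, A, π, h⟩ := exists_isMatrixPresentation (R := R) (M := M)
  obtain ⟨d, hd⟩ := exists_isGcdOfIdeal (minorIdeal A)
  exact ⟨d, p, q, A, π, h, hd⟩

end Fitting

/-! ### The group ring of a free abelian group -/

lemma exists_C_mem_span_pair {Q : Type*} [CommRing Q] [IsDomain Q] [UniqueFactorizationMonoid Q]
    {f g : Polynomial Q} (hf : Irreducible f) (hdeg : f.natDegree ≠ 0) (hfg : ¬ f ∣ g) :
    ∃ r ≠ 0, Polynomial.C r ∈ Ideal.span {f, g} := by
  let K := FractionRing Q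
  let _ := Polynomial.algebra Q K
  have := Polynomial.isLocalization (nonZeroDivisors Q) K
  have hprim := hf.isPrimitive hdeg
  have hirr := (hprim.irreducible_iff_irreducible_map_fraction_map (K := K)).1 hf
  rw [hprim.dvd_iff_fraction_map_dvd_fraction_map K] at hfg
  have hcop := (EuclideanDomain.dvd_or_coprime _ _ hirr).resolve_left hfg
  have htop : (Ideal.span {f, g}).map (algebraMap (Polynomial Q) (Polynomial K)) = ⊤ := by
    rw [Ideal.map_span, Set.image_pair]
    obtain ⟨a, b, hab⟩ := hcop
    exact (Ideal.eq_top_iff_one _).2 (Ideal.mem_span_pair.2 ⟨a, b, hab⟩)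
  have hmeet := mt (IsLocalization.map_algebraMap_ne_top_iff_disjoint
    ((nonZeroDivisors Q).map Polynomial.C) (Polynomial K) (Ideal.span {f, g})).2 (not_not.2 htop)
  obtain ⟨_, ⟨r, hr, rfl⟩, hmem⟩ := Set.not_disjoint_iff.1 hmeet
  exact ⟨r, nonZeroDivisors.ne_zero hr, hmem⟩

lemma isPrincipal_of_forall_C_mem_eq_zero {Q : Type*} [CommRing Q] [IsDomain Q]
    [UniqueFactorizationMonoid Q] (P : Ideal (Polynomial Q)) [hP : P.IsPrime]
    (h : ∀ r, Polynomial.C r ∈ P → r = 0) : P.IsPrincipal := by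
  by_cases hbot : P = ⊥
  · exact hbot ▸ bot_isPrincipal
  obtain ⟨f, hfP, hf⟩ := hP.exists_mem_prime_of_ne_bot hbot
  have hdeg : f.natDegree ≠ 0 := fun hconst => hf.ne_zero (by
    rw [Polynomial.eq_C_of_natDegree_eq_zero hconst] at hfP ⊢
    rw [h _ hfP, map_zero])
  refine ⟨f, le_antisymm (fun g hg => ?_) ((Ideal.span_singleton_le_iff_mem _).2 hfP)⟩
  refine Ideal.mem_span_singleton.2 (by_contra fun hfg => ?_)
  obtain ⟨r, hr, hmem⟩ := exists_C_mem_span_pair hf.irreducible hdeg hfg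
  exact hr (h r (Ideal.span_le.2 (Set.pair_subset hfP hg) hmem))

lemma isPrincipal_of_forall_notMem_vars {σ k : Type*} [CommRing k] [IsDomain k]
    [UniqueFactorizationMonoid k] (i : σ) (P : Ideal (MvPolynomial σ k)) [P.IsPrime]
    (h : ∀ q ∈ P, i ∉ q.vars → q = 0) : P.IsPrincipal := by
  classical
  let e : Polynomial (MvPolynomial {j // j ≠ i} k) ≃ₐ[k] MvPolynomial σ k :=
    (MvPolynomial.optionEquivLeft k {j // j ≠ i}).symm.trans
      (MvPolynomial.renameEquiv k (Equiv.optionSubtypeNe i))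
  have he (q : MvPolynomial {j // j ≠ i} k) :
      e (Polynomial.C q) = MvPolynomial.rename Subtype.val q := by
    induction q using MvPolynomial.induction_on with
    | C a => simp [e]
    | add p q hp hq => simp only [map_add, hp, hq]
    | mul_X p j hp => simp only [map_mul, hp]; simp [e]
  have hcomap : (P.comap e).IsPrincipal := isPrincipal_of_forall_C_mem_eq_zero _ fun r hr => by
    have hri : i ∉ (e (Polynomial.C r)).vars := fun hi => by
      obtain ⟨j, -, hj⟩ := Finset.mem_image.1 (MvPolynomial.vars_rename Subtype.val r (he r ▸ hi))
      exact j.2 hj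
    simpa using h _ hr hri
  rw [← Ideal.map_comap_of_surjective e e.surjective P]
  exact hcomap.map_ringHom e

section PolynomialModel

variable {k A σ : Type*} [CommGroup A] (B : Module.Basis σ ℤ (Additive A))

/-- The group element with given natural coordinates. -/
def groupMonomial (m : σ →₀ ℕ) : A := m.prod fun i n => (B i).toMul ^ n

@[simp]
lemma repr_groupMonomial (m : σ →₀ ℕ) (i : σ) :
    B.repr (Additive.ofMul (groupMonomial B m)) i = m i := by
  have hsum : Additive.ofMul (groupMonomial B m) = m.sum fun j n => n • B j := by
    simp [groupMonomial, Finsupp.prod, Finsupp.sum, ofMul_prod]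
  classical
  rw [hsum, Finsupp.sum, map_sum, Finsupp.finsetSum_apply]
  simp +contextual [Finsupp.single_apply]

lemma groupMonomial_injective : Function.Injective (groupMonomial B) := fun m n h =>
  Finsupp.ext fun i => by
    simpa using congrArg (fun a => B.repr (Additive.ofMul a) i) h

variable [CommRing k]

variable (k) in
/-- The embedding of the polynomial ring into the group ring given by a basis of the group. -/
def polyMap : MvPolynomial σ k →ₐ[k] MonoidAlgebra k A :=
  MvPolynomial.aeval fun i => MonoidAlgebra.single (B i).toMul 1

lemma polyMap_monomial (m : σ →₀ ℕ) (c : k) :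
    polyMap k B (MvPolynomial.monomial m c) = MonoidAlgebra.single (groupMonomial B m) c := by
  simp [polyMap, MvPolynomial.aeval_monomial, MonoidAlgebra.single_pow, groupMonomial,
    Finsupp.prod, MonoidAlgebra.prod_single, MonoidAlgebra.single_mul_single]

lemma coeff_polyMap_groupMonomial (f : MvPolynomial σ k) (m : σ →₀ ℕ) :
    (polyMap k B f).coeff (groupMonomial B m) = f.coeff m := by
  classical
  induction f using MvPolynomial.induction_on' with
  | monomial n c =>
    simp [polyMap_monomial, Finsupp.single_apply, MvPolynomial.coeff_monomial,
      (groupMonomial_injective B).eq_iff]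
  | add p q hp hq => simp [hp, hq]

lemma exists_of_coeff_polyMap_ne_zero {f : MvPolynomial σ k} {a : A}
    (h : (polyMap k B f).coeff a ≠ 0) : ∃ m ∈ f.support, a = groupMonomial B m := by
  rw [f.as_sum] at h
  simp only [map_sum, polyMap_monomial, MonoidAlgebra.coeff_sum, Finsupp.finsetSum_apply] at h
  obtain ⟨m, hm, hne⟩ := Finset.exists_ne_zero_of_sum_ne_zero h
  exact ⟨m, hm, eq_of_coeff_single_ne_zero hne⟩

lemma polyMap_injective : Function.Injective (polyMap k B) :=
  (injective_iff_map_eq_zero _).2 fun f hf => MvPolynomial.ext _ _ fun m => by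
    rw [← coeff_polyMap_groupMonomial B, hf]
    simp

lemma isUnit_polyMap_monomial (m : σ →₀ ℕ) :
    IsUnit (polyMap k B (MvPolynomial.monomial m 1)) := by
  rw [polyMap_monomial]
  refine IsUnit.of_mul_eq_one (MonoidAlgebra.single (groupMonomial B m)⁻¹ 1) ?_
  simp [MonoidAlgebra.single_mul_single, MonoidAlgebra.one_def]

lemma exists_polyMap_eq_mul (r : MonoidAlgebra k A) :
    ∃ (m : σ →₀ ℕ) (f : MvPolynomial σ k),
      polyMap k B f = polyMap k B (MvPolynomial.monomial m 1) * r := by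
  induction r using MonoidAlgebra.induction_linear with
  | zero => exact ⟨0, 0, by simp⟩
  | add r s hr hs =>
    obtain ⟨m, f, hf⟩ := hr
    obtain ⟨n, g, hg⟩ := hs
    refine ⟨m + n, MvPolynomial.monomial n 1 * f + MvPolynomial.monomial m 1 * g, ?_⟩
    rw [← one_mul (1 : k), ← MvPolynomial.monomial_mul, one_mul]
    simp only [map_add, map_mul, hf, hg]
    ring
  | single a c =>
    let m := (B.repr (Additive.ofMul a)).mapRange (fun z => (-z).toNat) (by simp)
    let n := (B.repr (Additive.ofMul a)).mapRange Int.toNat (by simp)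
    refine ⟨m, MvPolynomial.monomial n c, ?_⟩
    rw [polyMap_monomial, polyMap_monomial, MonoidAlgebra.single_mul_single, one_mul]
    congr 1
    refine Additive.ofMul.injective (B.ext_elem fun i => ?_)
    simp only [ofMul_mul, map_add, Finsupp.add_apply, repr_groupMonomial, m, n,
      Finsupp.mapRange_apply]
    lia

variable (k) in
lemma isLocalization_polyMap :
    letI := (polyMap k B).toAlgebra
    IsLocalization ((IsUnit.submonoid (MonoidAlgebra k A)).comap (polyMap k B))
      (MonoidAlgebra k A) :=
  letI := (polyMap k B).toAlgebra
  { map_units := fun y => y.2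
    surj := fun r => by
      obtain ⟨m, f, hf⟩ := exists_polyMap_eq_mul B r
      exact ⟨⟨f, MvPolynomial.monomial m 1, isUnit_polyMap_monomial B m⟩,
        (mul_comm _ _).trans hf.symm⟩
    exists_of_eq := fun h => ⟨1, by rw [polyMap_injective B h]⟩ }

variable [UniqueFactorizationMonoid k]

include B in
variable (k) in
lemma uniqueFactorizationMonoid_of_basis :
    UniqueFactorizationMonoid (MonoidAlgebra k A) :=
  letI := (polyMap k B).toAlgebra
  have := isLocalization_polyMap k B
  UniqueFactorizationMonoid.of_isLocalization
    ((IsUnit.submonoid (MonoidAlgebra k A)).comap (polyMap k B)) _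

lemma isPrincipal_of_forall_repr_eq_zero [IsDomain k] (i : σ) (P : Ideal (MonoidAlgebra k A))
    [P.IsPrime]
    (h : ∀ r ∈ P, (∀ a, r.coeff a ≠ 0 → B.repr (Additive.ofMul a) i = 0) → r = 0) :
    P.IsPrincipal := by
  let _ := (polyMap k B).toAlgebra
  have := isLocalization_polyMap k B
  rw [← IsLocalization.map_under
    ((IsUnit.submonoid (MonoidAlgebra k A)).comap (polyMap k B)) _ P]
  refine Submodule.IsPrincipal.map_ringHom _
    (isPrincipal_of_forall_notMem_vars i (P.comap (polyMap k B)) fun q hq hi => ?_)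
  refine (map_eq_zero_iff _ (polyMap_injective B)).1 (h _ hq fun a ha => ?_)
  obtain ⟨m, hm, rfl⟩ := exists_of_coeff_polyMap_ne_zero B ha
  rw [repr_groupMonomial, Nat.cast_eq_zero]
  by_contra hmi
  exact hi ((MvPolynomial.mem_vars_iff_mem_support i).2 ⟨m, hm, Finsupp.mem_support_iff.2 hmi⟩)

end PolynomialModel

section RealGroups

variable {A : Type*} [CommGroup A] {v : A →* Multiplicative ℝ}

lemma exists_basis [Group.FG A] (hv : Function.Injective v) :
    ∃ n : ℕ, Nonempty (Module.Basis (Fin n) ℤ (Additive A)) := by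
  have : IsMulTorsionFree A := hv.isMulTorsionFree v
  have : Module.Free ℤ (Additive A) := Module.free_of_finite_type_torsion_free'
  exact ⟨_, ⟨Module.finBasis ℤ (Additive A)⟩⟩

lemma uniqueFactorizationMonoid_of_injective (k : Type*) [CommRing k]
    [UniqueFactorizationMonoid k] [Group.FG A] (hv : Function.Injective v) :
    UniqueFactorizationMonoid (MonoidAlgebra k A) := by
  obtain ⟨n, ⟨B⟩⟩ := exists_basis hv
  exact uniqueFactorizationMonoid_of_basis k B

end RealGroups

/-! ### Prime ideals without monic elements -/

section Primes

section Hyperplane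

variable {A σ : Type*} [CommGroup A] (B : Module.Basis σ ℤ (Additive A))

lemma exists_repr_injOn [Nonempty σ] {Γ : Type*} [DivisionMonoid Γ] {χ : A →* Γ}
    (hχ : Function.Injective χ) (ϖ : Γ) :
    ∃ i, ∀ (a : A) (k : ℤ), B.repr (Additive.ofMul a) i = 0 → χ a = ϖ ^ k → a = 1 := by
  by_cases! hpow : ∃ (a : A) (k : ℤ), χ a = ϖ ^ k ∧ a ≠ 1
  · obtain ⟨a, k, hk, ha⟩ := hpow
    obtain ⟨i, hi⟩ : ∃ i, B.repr (Additive.ofMul a) i ≠ 0 := by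
      by_contra! h
      exact ha (Additive.ofMul.injective (B.ext_elem fun i => by simp [h i]))
    refine ⟨i, fun b l hb hl => ?_⟩
    have hab : a ^ l = b ^ k := hχ (by rw [map_zpow, map_zpow, hk, hl, ← zpow_mul, zpow_mul'])
    have hcoord := congrArg (fun x => B.repr (Additive.ofMul x) i) hab
    simp only [ofMul_zpow, map_zsmul, Finsupp.smul_apply, hb, smul_zero] at hcoord
    obtain rfl : l = 0 := (smul_eq_zero.1 hcoord).resolve_right hi
    exact hχ (by rw [hl, zpow_zero, map_one])
  · exact ⟨Classical.arbitrary σ, fun a k _ => hpow a k⟩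

lemma sum_ne_zero_of_injOn_valuation {ι K Γ : Type*} [Ring K]
    [LinearOrderedCommGroupWithZero Γ] (w : Valuation K Γ) {s : Finset ι} (hs : s.Nonempty)
    {g : ι → K} (hg : ∀ i ∈ s, w (g i) ≠ 0) (hinj : Set.InjOn (fun i => w (g i)) s) :
    ∑ i ∈ s, g i ≠ 0 := by
  classical
  obtain ⟨j, hj, hmax⟩ := s.exists_max_image (fun i => w (g i)) hs
  have hsum := w.map_sum_eq_of_lt hj fun i hi => by
    obtain ⟨hi, hij⟩ := Finset.mem_sdiff.1 hi
    exact (hmax i hi).lt_of_ne fun e => hij (Finset.mem_singleton.2 (hinj hi hj e))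
  intro hzero
  rw [hzero, map_zero] at hsum
  exact hg j hj hsum.symm

variable {K : Type*} [Field K]

lemma exists_valuation_intCast_eq_pow [CharZero K] (V : ValuationSubring K) :
    ∃ ϖ ≠ 0, ∀ c : ℤ, c ≠ 0 → ∃ n : ℕ, V.valuation (c : K) = ϖ ^ n := by
  let P := (IsLocalRing.maximalIdeal V).comap (Int.castRingHom V)
  have hnotMem (c : ℤ) (hc : c ∉ P) : V.valuation (c : K) = 1 :=
    (V.valuation_le_one (c : V)).antisymm (not_lt.1 (mt (V.valuation_lt_one_iff (c : V)).2 hc))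
  by_cases hP : P = ⊥
  · exact ⟨1, one_ne_zero, fun c hc => ⟨0, by simpa using hnotMem c (by simpa [hP] using hc)⟩⟩
  let p : ℤ := Submodule.IsPrincipal.generator P
  have hprime : Prime p := Submodule.IsPrincipal.prime_generator_of_isPrime P hP
  refine ⟨V.valuation (p : K), (map_ne_zero _).2 (Int.cast_ne_zero.2 hprime.ne_zero),
    fun c hc => ?_⟩
  obtain ⟨d, hcd, hd⟩ :=
    (FiniteMultiplicity.of_prime_left hprime hc).exists_eq_pow_mul_and_not_dvd
  refine ⟨multiplicity p c, ?_⟩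
  conv_lhs => rw [hcd]
  rw [Int.cast_mul, map_mul, Int.cast_pow, map_pow,
    hnotMem d (mt (Submodule.IsPrincipal.mem_iff_generator_dvd P).1 hd), mul_one]

/-- The valuation of the image of a group element, under a homomorphism from the group ring to a
valued field. -/
def groupValuation {k A K Γ : Type*} [Semiring k] [Monoid A] [Field K]
    [LinearOrderedCommGroupWithZero Γ] (w : Valuation K Γ) (f : MonoidAlgebra k A →+* K) : A →* Γ :=
  (w : K →* Γ).comp ((f : MonoidAlgebra k A →* K).comp (MonoidAlgebra.of k A))

lemma exists_forall_map_ne_zero [Nonempty σ] [CharZero K] (f : MonoidAlgebra ℤ A →+* K)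
    (V : ValuationSubring K) (hV : Function.Injective (groupValuation V.valuation f)) :
    ∃ i, ∀ r ≠ 0, (∀ a, r.coeff a ≠ 0 → B.repr (Additive.ofMul a) i = 0) → f r ≠ 0 := by
  let χ := groupValuation V.valuation f
  have hχ (a : A) : χ a ≠ 0 := ((Group.isUnit a).map χ).ne_zero
  obtain ⟨ϖ, hϖ, hpow⟩ := exists_valuation_intCast_eq_pow V
  obtain ⟨i, hi⟩ := exists_repr_injOn B hV ϖ
  have hterm (a : A) (c : ℤ) :
      V.valuation (f (MonoidAlgebra.single a c)) = V.valuation (c : K) * χ a := by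
    have : MonoidAlgebra.single a c = (c : MonoidAlgebra ℤ A) * MonoidAlgebra.single a 1 := by
      simp [MonoidAlgebra.intCast_def, MonoidAlgebra.single_mul_single]
    rw [this, map_mul, map_mul, map_intCast]
    rfl
  refine ⟨i, fun r hr hri => ?_⟩
  rw [← MonoidAlgebra.sum_coeff_single r, Finsupp.sum, map_sum]
  refine sum_ne_zero_of_injOn_valuation V.valuation
    (Finsupp.support_nonempty_iff.2 (by simpa using hr)) (fun a ha => ?_) fun a ha b hb hab => ?_
  · rw [hterm]
    exact mul_ne_zero (by simpa using ha) (hχ a)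
  replace ha : r.coeff a ≠ 0 := by simpa using ha
  replace hb : r.coeff b ≠ 0 := by simpa using hb
  obtain ⟨m, hm⟩ := hpow _ ha
  obtain ⟨n, hn⟩ := hpow _ hb
  refine div_eq_one.1 (hi (a / b) (n - m) (by simp [ofMul_div, hri a ha, hri b hb]) ?_)
  simp only [hterm, hm, hn] at hab
  rw [zpow_sub₀ hϖ, zpow_natCast, zpow_natCast, eq_div_iff (pow_ne_zero _ hϖ)]
  refine mul_right_cancel₀ (hχ b) ?_
  rw [mul_right_comm, ← map_mul, div_mul_cancel, mul_comm, hab]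

end Hyperplane

variable {A : Type*} [CommGroup A] {v : A →* Multiplicative ℝ}

lemma exists_eq_smul_add (p : ℤ) (f : MonoidAlgebra ℤ A) :
    ∃ g h : MonoidAlgebra ℤ A, f = p • g + h ∧ ∀ a, p ∣ h.coeff a → h.coeff a = 0 := by
  refine ⟨.ofCoeff (f.coeff.mapRange (· / p) (by simp)),
    .ofCoeff (f.coeff.mapRange (· % p) (by simp)), ?_, fun a ha => ?_⟩
  · ext a
    simp [-zsmul_eq_mul, Int.mul_ediv_add_emod]
  · simpa using Int.emod_eq_zero_of_dvd ha

lemma eq_span_of_intCast_mem (hv : Function.Injective v) (P : Ideal (MonoidAlgebra ℤ A))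
    (hP : ∀ r ∈ P, ¬ IsMonic v r) {p : ℤ} (hp : Prime p) (hpP : (p : MonoidAlgebra ℤ A) ∈ P) :
    P = Ideal.span {(p : MonoidAlgebra ℤ A)} := by
  have hsmul (g : MonoidAlgebra ℤ A) : p • g ∈ Ideal.span {(p : MonoidAlgebra ℤ A)} := by
    rw [zsmul_eq_mul]
    exact Ideal.mul_mem_right _ _ (Ideal.mem_span_singleton_self _)
  have hspan : Ideal.span {(p : MonoidAlgebra ℤ A)} ≤ P := (Ideal.span_singleton_le_iff_mem _).2 hpP
  refine le_antisymm (fun f hf => ?_) hspan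
  obtain ⟨g, h, rfl, hh⟩ := exists_eq_smul_add p f
  have hhP : h ∈ P := (Ideal.add_mem_iff_right _ (hspan (hsmul g))).1 hf
  suffices h = 0 by simpa only [this, add_zero] using hsmul g
  by_contra hne
  obtain ⟨a, ha⟩ := exists_isInitial hv hne
  obtain ⟨x, y, hxy⟩ := hp.coprime_iff_not_dvd.2 (mt (hh a) ha.1)
  refine hP (p • MonoidAlgebra.single a x + y • h)
    (add_mem (hspan (hsmul _)) (zsmul_mem hhP y)) ⟨a, Or.inl ?_, fun b hba hb => ha.2 b hba ?_⟩
  · simpa [-zsmul_eq_mul, mul_comm p] using hxy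
  · exact fun h0 => hb (by simp [-zsmul_eq_mul, h0, hba.symm])

lemma exists_valuationSubring {K : Type*} [Field K] (hv : Function.Injective v)
    (f : MonoidAlgebra ℤ A →+* K) (hf : ∀ r, f r = 0 → ¬ IsMonic v r) :
    ∃ V : ValuationSubring K, ∀ a : A, 0 < (v a).toAdd →
      V.valuation (f (MonoidAlgebra.single a 1)) < 1 := by
  let f' : nonnegSubring ℤ v →+* K := f.comp (nonnegSubring ℤ v).subtype
  let I : Ideal f'.range := (RingHom.ker (constCoeff hv)).map f'.rangeRestrict
  have hI : I ≠ ⊤ := by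
    rw [Ne, Ideal.eq_top_iff_one, Ideal.mem_map_iff_of_surjective _ f'.rangeRestrict_surjective]
    rintro ⟨y, hy, hone⟩
    have hfy : f' y = 1 := congrArg Subtype.val hone
    refine hf (1 - y : nonnegSubring ℤ v).1 ?_ (isMonic_of_isUnit_constCoeff hv (1 - y) ?_)
    · change f' (1 - y) = 0
      rw [map_sub, hfy, map_one, sub_self]
    · rw [map_sub, RingHom.mem_ker.1 hy, map_one, sub_zero]
      exact isUnit_one
  obtain ⟨V, _, hIV⟩ := I.image_subset_nonunits_valuationSubring hI
  exact ⟨V, fun a ha => (ValuationSubring.mem_nonunits_iff _).1 (hIV ⟨f'.rangeRestrict _,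
    Ideal.mem_map_of_mem _ (RingHom.mem_ker.2 (constCoeff_single_of_pos hv ha 1)), rfl⟩)⟩

lemma exists_valuation_injective {K : Type*} [Field K] (hv : Function.Injective v)
    (f : MonoidAlgebra ℤ A →+* K) (hf : ∀ r, f r = 0 → ¬ IsMonic v r) :
    ∃ V : ValuationSubring K, Function.Injective (groupValuation V.valuation f) := by
  obtain ⟨V, hV⟩ := exists_valuationSubring hv f hf
  let χ := groupValuation V.valuation f
  refine ⟨V, (injective_iff_map_eq_one χ).2 fun a ha => ?_⟩
  have hlt (b : A) (hb : χ b = 1) : (v b).toAdd ≤ 0 := not_lt.1 fun h => (hV b h).ne hb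
  refine hv (Multiplicative.toAdd.injective (le_antisymm (by simpa using hlt a ha) ?_))
  simpa using hlt a⁻¹ (by rw [map_inv, ha, inv_one])

lemma isPrincipal_of_forall_not_isMonic [Group.FG A] (hv : Function.Injective v)
    (P : Ideal (MonoidAlgebra ℤ A)) [P.IsPrime] (hP : ∀ r ∈ P, ¬ IsMonic v r) :
    P.IsPrincipal := by
  obtain ⟨n, ⟨B⟩⟩ := exists_basis hv
  rcases isEmpty_or_nonempty (Fin n) with _ | _
  · have : Subsingleton A := ⟨fun a b => Additive.ofMul.injective (B.ext_elem isEmptyElim)⟩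
    have := IsPrincipalIdealRing.of_surjective (MonoidAlgebra.uniqueRingEquiv (R := ℤ) A).symm
      (RingEquiv.surjective _)
    exact IsPrincipalIdealRing.principal P
  by_cases hint : P.comap (Int.castRingHom (MonoidAlgebra ℤ A)) = ⊥
  · let f := algebraMap (MonoidAlgebra ℤ A) P.ResidueField
    have hf (r) : f r = 0 ↔ r ∈ P := Ideal.algebraMap_residueField_eq_zero
    have : CharZero P.ResidueField := charZero_of_inj_zero fun m hm => by
      have hm' : (m : ℤ) ∈ P.comap (Int.castRingHom (MonoidAlgebra ℤ A)) := by
        simpa [← hf] using hm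
      simpa [hint] using hm'
    obtain ⟨V, hV⟩ := exists_valuation_injective hv f fun r hr => hP r ((hf r).1 hr)
    obtain ⟨i, hi⟩ := exists_forall_map_ne_zero B f V hV
    exact isPrincipal_of_forall_repr_eq_zero B i P fun r hr hri =>
      by_contra fun hne => hi r hne hri ((hf r).2 hr)
  · obtain ⟨p, hpP, hp⟩ := Ideal.IsPrime.exists_mem_prime_of_ne_bot inferInstance hint
    exact ⟨p, eq_span_of_intCast_mem hv P hP hp hpP⟩

theorem IsGcdOfIdeal.isMonic_iff [Group.FG A] (hv : Function.Injective v)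
    {I : Ideal (MonoidAlgebra ℤ A)} {d : MonoidAlgebra ℤ A} (hd : IsGcdOfIdeal I d) :
    IsMonic v d ↔ ∃ s ∈ I, IsMonic v s := by
  constructor
  · intro hmonic
    by_contra! hI
    obtain ⟨P, hP, hIP, hdisj⟩ := Ideal.exists_le_prime_disjoint I (monicSubmonoid hv)
      (Set.disjoint_left.2 hI)
    have hPmonic (r) (hr : r ∈ P) : ¬ IsMonic v r := Set.disjoint_left.1 hdisj hr
    have := isPrincipal_of_forall_not_isMonic hv P hPmonic
    refine hPmonic d ((Submodule.IsPrincipal.mem_iff_generator_dvd P).2 ?_) hmonic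
    exact (hd _).2 fun x hx => (Submodule.IsPrincipal.mem_iff_generator_dvd P).1 (hIP hx)
  · rintro ⟨s, hs, hmonic⟩
    obtain ⟨c, rfl⟩ := (hd d).1 dvd_rfl s hs
    exact ((isMonic_mul_iff hv).1 hmonic).1

lemma IsOrder.isMonic_iff [Group.FG A] (hv : Function.Injective v) {M : Type*}
    [AddCommGroup M] [Module (MonoidAlgebra ℤ A) M] {d : MonoidAlgebra ℤ A}
    (hd : IsOrder (MonoidAlgebra ℤ A) M d) :
    IsMonic v d ↔ ∃ s ∈ Module.annihilator (MonoidAlgebra ℤ A) M, IsMonic v s := by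
  obtain ⟨p, q, B, π, h, hd⟩ := hd
  rw [hd.isMonic_iff hv]
  constructor
  · rintro ⟨s, hs, hm⟩
    exact ⟨s, h.minorIdeal_le_annihilator hs, hm⟩
  · rintro ⟨s, hs, hm⟩
    exact ⟨s ^ p, h.pow_mem_minorIdeal hs, pow_mem (S := monicSubmonoid hv) hm p⟩

end Primes

/-! ### The Novikov completion as a module over the group ring -/

section NovikovModule

open Filter Topology

variable {A : Type*} [CommGroup A] {v : A →* Multiplicative ℝ}

variable (v) in
/-- The Novikov completion, as a module over the group ring. -/
abbrev NovikovModule : Type _ := (novikovRep v).asModule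

/-- The coefficients of an element of the Novikov completion. -/
def novCoeff : NovikovModule v →+ (A → ℤ) := (novikov v).subtype.toAddMonoidHom

/-- The element of the Novikov completion with given coefficients. -/
def novMk (f : A → ℤ) (hf : ∀ C : ℝ, {g : A | f g ≠ 0 ∧ (v g).toAdd ≤ C}.Finite) :
    NovikovModule v := (⟨f, hf⟩ : novikov v)

@[simp]
lemma novCoeff_novMk (f : A → ℤ) (hf : ∀ C : ℝ, {g : A | f g ≠ 0 ∧ (v g).toAdd ≤ C}.Finite) :
    novCoeff (novMk f hf) = f := rfl

@[ext]
lemma novikovModule_ext {x y : NovikovModule v} (h : ∀ g, novCoeff x g = novCoeff y g) : x = y :=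
  Subtype.val_injective (funext h)

lemma finite_novCoeff (x : NovikovModule v) (C : ℝ) :
    {g : A | novCoeff x g ≠ 0 ∧ (v g).toAdd ≤ C}.Finite :=
  (show novikov v from x).2 C

lemma exists_forall_le_of_novCoeff_ne_zero (x : NovikovModule v) :
    ∃ b : ℝ, ∀ g, novCoeff x g ≠ 0 → b ≤ (v g).toAdd := by
  obtain ⟨b, hb⟩ := ((finite_novCoeff x 0).image fun g => (v g).toAdd).bddBelow
  refine ⟨min b 0, fun g hg => ?_⟩
  rcases le_total (v g).toAdd 0 with h | h
  · exact (min_le_left b 0).trans (hb ⟨g, ⟨hg, h⟩, rfl⟩)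
  · exact (min_le_right b 0).trans h

lemma novCoeff_single_smul (a : A) (c : ℤ) (x : NovikovModule v) (g : A) :
    novCoeff (MonoidAlgebra.single a c • x) g = c * novCoeff x (a⁻¹ * g) := by
  rw [Representation.single_smul]
  rfl

lemma novCoeff_smul (r : MonoidAlgebra ℤ A) (x : NovikovModule v) (g : A) :
    novCoeff (r • x) g = ∑ a ∈ r.coeff.support, r.coeff a * novCoeff x (a⁻¹ * g) := by
  conv_lhs => rw [← MonoidAlgebra.sum_coeff_single r]
  rw [Finsupp.sum, Finset.sum_smul, map_sum, Finset.sum_apply]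
  simp only [novCoeff_single_smul]

lemma exists_mul_eq_of_novCoeff_smul_ne_zero {r : MonoidAlgebra ℤ A} {x : NovikovModule v} {g : A}
    (h : novCoeff (r • x) g ≠ 0) :
    ∃ a b, r.coeff a ≠ 0 ∧ novCoeff x b ≠ 0 ∧ a * b = g := by
  rw [novCoeff_smul] at h
  obtain ⟨a, -, ha⟩ := Finset.exists_ne_zero_of_sum_ne_zero h
  exact ⟨a, a⁻¹ * g, left_ne_zero_of_mul ha, right_ne_zero_of_mul ha, mul_inv_cancel_left _ _⟩

variable (v) in
/-- The embedding of the group ring into its Novikov completion. -/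
def toNovikov : MonoidAlgebra ℤ A →ₗ[MonoidAlgebra ℤ A] NovikovModule v :=
  LinearMap.toSpanSingleton _ _ (novMk (fun g => (1 : MonoidAlgebra ℤ A).coeff g) fun _ =>
    ((1 : MonoidAlgebra ℤ A).coeff.support.finite_toSet).subset fun _ hg =>
      Finsupp.mem_support_iff.2 hg.1)

@[simp]
lemma novCoeff_toNovikov (r : MonoidAlgebra ℤ A) (g : A) :
    novCoeff (toNovikov v r) g = r.coeff g := by
  classical
  rw [toNovikov, LinearMap.toSpanSingleton_apply, novCoeff_smul, novCoeff_novMk]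
  simp only [MonoidAlgebra.one_def, MonoidAlgebra.coeff_single, Finsupp.single_apply,
    eq_inv_mul_iff_mul_eq, mul_one]
  simp [eq_comm]

lemma toNovikov_injective : Function.Injective (toNovikov v) := fun r s h => by
  ext g
  simpa using congrArg (novCoeff · g) h

/-- The part of a series consisting of the terms where `v` is at most `C`. -/
def truncate (C : ℝ) : NovikovModule v →+ MonoidAlgebra ℤ A where
  toFun x := .ofCoeff (Finsupp.ofSupportFinite ({g | (v g).toAdd ≤ C}.indicator (novCoeff x))
    ((finite_novCoeff x C).subset fun g hg => by simpa [and_comm] using hg))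
  map_zero' := by
    ext g
    simp [Finsupp.ofSupportFinite_coe]
  map_add' x y := by
    ext g
    simp [Finsupp.ofSupportFinite_coe, Set.indicator_add']

lemma coeff_truncate (C : ℝ) (x : NovikovModule v) (g : A) :
    (truncate C x).coeff g = {g | (v g).toAdd ≤ C}.indicator (novCoeff x) g := rfl

variable {ι : Type*} {l : Filter ι}

variable (v l) in
/-- The families of elements of the Novikov completion which tend to zero along `l`: the minimum of
`v` on the support tends to infinity. -/
def nullFamilies : Submodule (MonoidAlgebra ℤ A) (ι → NovikovModule v) where
  carrier := {x | ∀ B : ℝ, ∀ᶠ i in l, ∀ g, novCoeff (x i) g ≠ 0 → B ≤ (v g).toAdd}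
  zero_mem' B := by simp
  add_mem' {x y} hx hy B := by
    filter_upwards [hx B, hy B] with i hxi hyi g hg
    by_cases h : novCoeff (x i) g = 0
    · exact hyi g fun h' => hg (by simp [h, h'])
    · exact hxi g h
  smul_mem' r x hx B := by
    have : ∀ᶠ i in l, ∀ a ∈ r.coeff.support, ∀ g, novCoeff (x i) g ≠ 0 →
        B - (v a).toAdd ≤ (v g).toAdd := (eventually_all_finset _).2 fun a _ => hx _
    filter_upwards [this] with i hi g hg
    obtain ⟨a, b, ha, hb, rfl⟩ := exists_mul_eq_of_novCoeff_smul_ne_zero hg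
    have := hi a (by simpa using ha) b hb
    simp only [map_mul, toAdd_mul]
    linarith

lemma eq_zero_of_const_mem_nullFamilies [l.NeBot] {x : NovikovModule v}
    (hx : (fun _ => x) ∈ nullFamilies v l) : x = 0 := by
  ext g
  by_contra hg
  obtain ⟨_, hi⟩ := (hx ((v g).toAdd + 1)).exists
  linarith [hi g hg]

lemma sub_truncate_mem_nullFamilies (x : NovikovModule v) :
    (fun C => x - toNovikov v (truncate C x)) ∈ nullFamilies v atTop := by
  intro B
  filter_upwards [eventually_ge_atTop B] with C hC g hg
  by_contra! h
  refine hg ?_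
  rw [map_sub, Pi.sub_apply, novCoeff_toNovikov, coeff_truncate,
    Set.indicator_of_mem (show g ∈ {g | (v g).toAdd ≤ C} from h.le.trans hC), sub_self]

/-- As the topology is non-archimedean, a series converges as soon as its terms tend to zero. -/
lemma exists_sub_sum_mem_nullFamilies {x : ℕ → NovikovModule v} (hx : x ∈ nullFamilies v atTop) :
    ∃ z, (fun n => z - ∑ i ∈ Finset.range n, x i) ∈ nullFamilies v atTop := by
  choose N hN using fun B => eventually_atTop.1 (hx B)
  let S (n : ℕ) : NovikovModule v := ∑ i ∈ Finset.range n, x i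
  have hS (B : ℝ) (n : ℕ) (hn : N B ≤ n) (g : A) (hg : (v g).toAdd < B) :
      novCoeff (S n) g = novCoeff (S (N B)) g := by
    induction n, hn using Nat.le_induction with
    | base => rfl
    | succ n hn ih =>
      have hxn : novCoeff (x n) g = 0 := by
        by_contra h
        exact (hN B n hn g h).not_gt hg
      rw [← ih, show S (n + 1) = S n + x n from Finset.sum_range_succ x n, map_add, Pi.add_apply,
        hxn, add_zero]
  have hlim (B : ℝ) (g : A) (hg : (v g).toAdd < B) :
      novCoeff (S (N ((v g).toAdd + 1))) g = novCoeff (S (N B)) g := by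
    rw [← hS _ _ (le_max_left _ (N B)) g (lt_add_one _), hS B _ (le_max_right _ _) g hg]
  refine ⟨novMk (fun g => novCoeff (S (N ((v g).toAdd + 1))) g) fun C => ?_, fun B => ?_⟩
  · refine (finite_novCoeff (S (N (C + 1))) C).subset fun g ⟨hg, hC⟩ => ⟨?_, hC⟩
    rwa [hlim (C + 1) g (by linarith)] at hg
  · filter_upwards [eventually_ge_atTop (N B)] with n hn g hg
    by_contra! h
    refine hg ?_
    rw [map_sub, Pi.sub_apply, novCoeff_novMk, hlim B g h, sub_eq_zero]
    exact (hS B n hn g h).symm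

section GeometricSeries

variable {y : MonoidAlgebra ℤ A} (hy : ∀ g, y.coeff g ≠ 0 → 0 < (v g).toAdd)

include hy

lemma pow_smul_mem_nullFamilies (x : NovikovModule v) :
    (fun n : ℕ => y ^ n • x) ∈ nullFamilies v atTop := by
  obtain ⟨ε, hyε, hε⟩ : ∃ ε, (∀ g ∈ y.coeff.support, ε ≤ (v g).toAdd) ∧ 0 < ε :=
    have (g : A) (hg : g ∈ y.coeff.support) : ∀ᶠ ε in 𝓝[>] (0 : ℝ), ε ≤ (v g).toAdd :=
      mem_nhdsWithin_of_mem_nhds (Iic_mem_nhds (hy g (by simpa using hg)))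
    (((eventually_all_finset _).2 this).and self_mem_nhdsWithin).exists
  obtain ⟨b, hb⟩ := exists_forall_le_of_novCoeff_ne_zero x
  have hpow (n : ℕ) : ∀ g, novCoeff (y ^ n • x) g ≠ 0 → n * ε + b ≤ (v g).toAdd := by
    induction n with
    | zero => simpa using hb
    | succ n ih =>
      intro g hg
      rw [pow_succ', mul_smul] at hg
      obtain ⟨c, d, hc, hd, rfl⟩ := exists_mul_eq_of_novCoeff_smul_ne_zero hg
      have hcε := hyε c (by simpa using hc)
      have hdn := ih d hd
      simp only [map_mul, toAdd_mul]
      push_cast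
      linarith
  intro B
  have htends : Tendsto (fun n : ℕ => n * ε + b) atTop atTop :=
    tendsto_atTop_add_const_right _ _ (tendsto_natCast_atTop_atTop.atTop_mul_const hε)
  filter_upwards [htends.eventually_ge_atTop B] with n hn g hg
  exact hn.trans (hpow n g hg)

lemma bijective_one_sub_smul : Function.Bijective fun x : NovikovModule v => (1 - y) • x := by
  constructor
  · refine (injective_iff_map_eq_zero (LinearMap.lsmul _ (NovikovModule v) (1 - y))).2
      fun x hx => ?_
    have hyx : y • x = x := by
      rw [LinearMap.lsmul_apply, sub_smul, one_smul, sub_eq_zero] at hx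
      exact hx.symm
    have hpow (n : ℕ) : y ^ n • x = x := by
      induction n with
      | zero => rw [pow_zero, one_smul]
      | succ n ih => rw [pow_succ, mul_smul, hyx, ih]
    exact eq_zero_of_const_mem_nullFamilies (l := (atTop : Filter ℕ))
      (by simpa only [hpow] using pow_smul_mem_nullFamilies hy x)
  · intro x
    obtain ⟨z, hz⟩ := exists_sub_sum_mem_nullFamilies (pow_smul_mem_nullFamilies hy x)
    refine ⟨z, sub_eq_zero.1 (eq_zero_of_const_mem_nullFamilies (l := (atTop : Filter ℕ)) ?_)⟩
    convert sub_mem (Submodule.smul_mem _ (1 - y) hz) (pow_smul_mem_nullFamilies hy x)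
      using 2 with n
    have hgeom : (1 - y) • ∑ i ∈ Finset.range n, y ^ i • x = x - y ^ n • x := by
      rw [← Finset.sum_smul, smul_smul, mul_neg_geom_sum, sub_smul, one_smul]
    simp only [Pi.sub_apply, Pi.smul_apply, smul_sub (1 - y) z, hgeom]
    abel

end GeometricSeries

lemma IsMonic.exists_isUnit_mul_eq_one_sub {s : MonoidAlgebra ℤ A} (hs : IsMonic v s) :
    ∃ t y : MonoidAlgebra ℤ A, IsUnit t ∧ t * s = 1 - y ∧ ∀ g, y.coeff g ≠ 0 → 0 < (v g).toAdd := by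
  obtain ⟨a, ha, hunit⟩ := isMonic_iff_exists_isInitial.1 hs
  have hcc : s.coeff a * s.coeff a = 1 := Int.isUnit_mul_self hunit
  have hinv : MonoidAlgebra.single a⁻¹ (s.coeff a) * MonoidAlgebra.single a (s.coeff a) = 1 := by
    rw [MonoidAlgebra.single_mul_single, hcc, inv_mul_cancel, MonoidAlgebra.one_def]
  refine ⟨MonoidAlgebra.single a⁻¹ (s.coeff a), 1 - MonoidAlgebra.single a⁻¹ (s.coeff a) * s,
    .of_mul_eq_one _ hinv, (sub_sub_cancel _ _).symm, fun g hg => ?_⟩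
  have hcoeff : (MonoidAlgebra.single a⁻¹ (s.coeff a) * s).coeff g =
      s.coeff a * s.coeff (a * g) := by
    rw [MonoidAlgebra.coeff_single_mul_apply, inv_inv]
  rw [MonoidAlgebra.coeff_sub, Finsupp.sub_apply, hcoeff] at hg
  by_cases hg1 : g = 1
  · simp [hg1, hcc, MonoidAlgebra.one_def] at hg
  · have hs0 : s.coeff (a * g) ≠ 0 := fun h => hg (by simp [h, MonoidAlgebra.one_def, hg1])
    simpa using ha.2 (a * g) (by simpa using hg1) hs0

lemma IsMonic.bijective_smul {s : MonoidAlgebra ℤ A} (hs : IsMonic v s) :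
    Function.Bijective fun x : NovikovModule v => s • x := by
  obtain ⟨t, y, ht, hts, hy⟩ := hs.exists_isUnit_mul_eq_one_sub
  refine (Function.Bijective.of_comp_iff' ht.smul_bijective _).1 ?_
  convert bijective_one_sub_smul hy using 2 with x
  rw [Function.comp_apply, smul_smul, hts]

end NovikovModule

/-! ### Twisted modules of functions -/

section TwistedChains

universe w

variable {R G X Y E E' : Type w} [CommRing R] [Group G] [MulAction G X] [AddCommGroup E]
  [Module R E] [AddCommGroup E'] [Module R E'] (χ : G →* R)

variable (X E) in
/-- The `R`-module `E ^ X` as a representation of `G`, with `G` acting on `E` through a character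
`χ : G → R` and by translation on the index set `X`. -/
def twistedRep : Representation R G (X → E) where
  toFun g := χ g • LinearMap.funLeft R E (g⁻¹ • · : X → X)
  map_one' := by
    ext f x
    simp
  map_mul' g h := by
    ext f x
    simp [mul_smul, smul_comm (χ g) (χ h)]

lemma twistedRep_apply (g : G) (f : X → E) (x : X) :
    twistedRep X E χ g f x = χ g • f (g⁻¹ • x) := rfl

/-- The map on chains induced by a linear map of coefficients. -/
def chainMap (φ : E →ₗ[R] E') : (Y →₀ (X → E)) →ₗ[R] (Y →₀ (X → E')) :=
  Finsupp.mapRange.linearMap (φ.compLeft X)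

@[simp]
lemma chainMap_single (φ : E →ₗ[R] E') (y : Y) (f : X → E) :
    chainMap φ (Finsupp.single y f) = Finsupp.single y (φ ∘ f) :=
  Finsupp.mapRange_single (hf := map_zero (φ.compLeft X))

lemma compLeft_twistedRep (φ : E →ₗ[R] E') (g : G) (f : X → E) :
    φ.compLeft X (twistedRep X E χ g f) = twistedRep X E' χ g (φ.compLeft X f) :=
  funext fun _ => map_smul φ _ _

lemma diffOne_chainMap (φ : E →ₗ[R] E') (z : G →₀ (X → E)) :
    diffOne (twistedRep X E' χ) (chainMap φ z) =
      φ.compLeft X (diffOne (twistedRep X E χ) z) :=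
  diffOne_mapRange (φ.compLeft X).toAddMonoidHom (compLeft_twistedRep χ φ) z

lemma diffTwo_chainMap (φ : E →ₗ[R] E') (w : G × G →₀ (X → E)) :
    diffTwo (twistedRep X E' χ) (chainMap φ w) = chainMap φ (diffTwo (twistedRep X E χ) w) :=
  diffTwo_mapRange (φ.compLeft X).toAddMonoidHom (compLeft_twistedRep χ φ) w

lemma chainMap_mem_boundaries (φ : E →ₗ[R] E') {z : G →₀ (X → E)}
    (hz : z ∈ boundaries (twistedRep X E χ)) : chainMap φ z ∈ boundaries (twistedRep X E' χ) :=
  mapRange_mem_boundaries (φ.compLeft X).toAddMonoidHom (compLeft_twistedRep χ φ) hz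

lemma mem_boundaries_of_smul_mem {s : R} (hs : Function.Bijective fun x : E => s • x)
    {z : G →₀ (X → E)} (hz : s • z ∈ boundaries (twistedRep X E χ)) :
    z ∈ boundaries (twistedRep X E χ) := by
  let τ : E ≃ₗ[R] E := LinearEquiv.ofBijective (LinearMap.lsmul R E s) hs
  convert chainMap_mem_boundaries χ τ.symm.toLinearMap hz
  ext g x
  exact (τ.symm_apply_apply (z g x)).symm

lemma chain_induction {E : Type*} [AddCommMonoid E] [Finite X] [DecidableEq X]
    {P : (Y →₀ (X → E)) → Prop} (zero : P 0) (add : ∀ a b, P a → P b → P (a + b))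
    (single : ∀ y x e, P (Finsupp.single y (Pi.single x e))) (z : Y →₀ (X → E)) : P z := by
  induction z using Finsupp.induction_linear with
  | zero => exact zero
  | add a b ha hb => exact add a b ha hb
  | single y f =>
    induction f using Pi.single_induction with
    | zero => simpa using zero
    | add f f' hf hf' => simpa using add _ _ hf hf'
    | single x e => exact single y x e

lemma eq_sum_smul_single {R : Type*} [Semiring R] [Fintype X] [DecidableEq X]
    {z : Y →₀ (X → R)} {S : Finset Y} (hS : z.support ⊆ S) :
    z = ∑ p ∈ S ×ˢ Finset.univ, z p.1 p.2 • Finsupp.single p.1 (Pi.single p.2 1) := by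
  have hrow (y : Y) : ∑ x, z y x • Finsupp.single y (Pi.single x (1 : R)) =
      Finsupp.single y (z y) := by
    conv_rhs => rw [← Finset.univ_sum_single (z y), Finsupp.single_finsetSum]
    simp only [Finsupp.smul_single, ← Pi.single_smul, smul_eq_mul, mul_one]
  rw [Finset.sum_product]
  simp only [hrow]
  conv_lhs => rw [← z.sum_single]
  exact z.sum_of_support_subset hS _ fun y _ => Finsupp.single_zero y

section CycleMap

variable (γ : G) (n : ℕ)

variable (X E) in
/-- The operator `1 + γ + ⋯ + γ ^ (n - 1)`. -/
def normMap : Module.End R (X → E) := ∑ i ∈ Finset.range n, twistedRep X E χ γ ^ i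

variable (X E) in
/-- If `γ ^ n` acts trivially on `X`, a retraction of the chains onto the cycles up to the scalar
factor `1 - χ γ ^ n`. -/
def cycleMap : (G →₀ (X → E)) →ₗ[R] (G →₀ (X → E)) :=
  (1 - χ γ ^ n) • LinearMap.id +
    Finsupp.lsingle γ⁻¹ ∘ₗ normMap X E χ γ n ∘ₗ diffOne (twistedRep X E χ)

lemma cycleMap_apply (z : G →₀ (X → E)) :
    cycleMap X E χ γ n z = (1 - χ γ ^ n) • z +
      Finsupp.single γ⁻¹ (normMap X E χ γ n (diffOne (twistedRep X E χ) z)) := rfl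

lemma cycleMap_of_mem_cycles {z : G →₀ (X → E)} (hz : z ∈ cycles (twistedRep X E χ)) :
    cycleMap X E χ γ n z = (1 - χ γ ^ n) • z := by
  rw [cycleMap_apply, mem_cycles.1 hz, map_zero, Finsupp.single_zero, add_zero]

lemma compLeft_normMap (φ : E →ₗ[R] E') (f : X → E) :
    φ.compLeft X (normMap X E χ γ n f) = normMap X E' χ γ n (φ.compLeft X f) := by
  simp only [normMap, LinearMap.sum_apply, map_sum, ← map_pow, compLeft_twistedRep]

lemma cycleMap_chainMap (φ : E →ₗ[R] E') (z : G →₀ (X → E)) :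
    cycleMap X E' χ γ n (chainMap φ z) = chainMap φ (cycleMap X E χ γ n z) := by
  rw [cycleMap_apply, cycleMap_apply, map_add, map_smul, diffOne_chainMap, chainMap_single,
    ← compLeft_normMap]
  rfl

variable {γ n}

lemma twistedRep_pow (hγ : ∀ x : X, γ ^ n • x = x) (f : X → E) :
    (twistedRep X E χ γ ^ n) f = χ γ ^ n • f := by
  funext x
  rw [← map_pow, twistedRep_apply, map_pow, inv_smul_eq_iff.2 (hγ x).symm, Pi.smul_apply]

lemma cycleMap_mem_cycles (hγ : ∀ x : X, γ ^ n • x = x) (z : G →₀ (X → E)) :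
    cycleMap X E χ γ n z ∈ cycles (twistedRep X E χ) := by
  have hgeom (f : X → E) : twistedRep X E χ γ (normMap X E χ γ n f) - normMap X E χ γ n f =
      χ γ ^ n • f - f := by
    have := LinearMap.congr_fun (mul_geom_sum (twistedRep X E χ γ) n) f
    rwa [LinearMap.sub_apply, twistedRep_pow χ hγ] at this
  rw [mem_cycles, cycleMap_apply, map_add, map_smul, diffOne_single, inv_inv, hgeom, sub_smul,
    one_smul]
  abel

/-- A chain over `E ^ X` is a sum of images of chains over `R ^ X`. The summands of a cycle need not
be cycles, but the operator `cycleMap` makes them cycles and multiplies their sum by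
`1 - χ γ ^ n`. -/
lemma mul_smul_mem_boundaries [Finite X] (hγ : ∀ x : X, γ ^ n • x = x) {s : R}
    (hs : ∀ z ∈ cycles (twistedRep X R χ), s • z ∈ boundaries (twistedRep X R χ))
    {z : G →₀ (X → E)} (hz : z ∈ cycles (twistedRep X E χ)) :
    (s * (1 - χ γ ^ n)) • z ∈ boundaries (twistedRep X E χ) := by
  classical
  suffices ∀ z, s • cycleMap X E χ γ n z ∈ boundaries (twistedRep X E χ) by
    rw [mul_smul, ← cycleMap_of_mem_cycles χ γ n hz]
    exact this z
  intro z
  induction z using chain_induction with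
  | zero => simp
  | add a b ha hb => rw [map_add, smul_add]; exact add_mem ha hb
  | single g x e =>
    have : Finsupp.single g (Pi.single x e) = chainMap (LinearMap.toSpanSingleton R E e)
        (Finsupp.single g (Pi.single x 1)) := by
      rw [chainMap_single]
      congr 1
      ext x'
      by_cases h : x' = x
      · subst h; simp
      · simp [h]
    rw [this, cycleMap_chainMap, ← map_smul]
    exact chainMap_mem_boundaries χ _ (hs _ (cycleMap_mem_cycles χ hγ _))

end CycleMap

end TwistedChains

/-! ### Homology with coefficients in the Novikov completion -/

section Approximation

open Filter

universe w

variable {A G X : Type w} [CommGroup A] [Group G] [MulAction G X] {v : A →* Multiplicative ℝ}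

lemma exists_isMonic_smul_eq_zero (hv : Function.Injective v) {M ι : Type*} [AddCommGroup M]
    [Module (MonoidAlgebra ℤ A) M] [Fintype ι] {y : MonoidAlgebra ℤ A}
    (hy : ∀ g, y.coeff g ≠ 0 → 0 < (v g).toAdd) {m : ι → M} {b : ι → ι → MonoidAlgebra ℤ A}
    (hb : ∀ i j g, (b i j).coeff g ≠ 0 → 0 < (v g).toAdd)
    (hm : ∀ i, (1 - y) • m i = ∑ j, b i j • m j) :
    ∃ s, IsMonic v s ∧ ∀ i, s • m i = 0 := by
  let R₀ := nonnegSubring ℤ v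
  let I : Ideal R₀ := RingHom.ker (constCoeff hv)
  let N : Submodule R₀ M := Submodule.span R₀ (Set.range m)
  have hsmul {a : MonoidAlgebra ℤ A} (ha : ∀ g, a.coeff g ≠ 0 → 0 < (v g).toAdd) (i : ι) :
      a • m i ∈ I • N := by
    have haI : (⟨a, fun g hg => (ha g hg).le⟩ : R₀) ∈ I := constCoeff_eq_zero hv ha
    exact Submodule.smul_mem_smul haI (Submodule.subset_span ⟨i, rfl⟩)
  have hNI : N ≤ I • N := by
    refine Submodule.span_le.2 ?_
    rintro _ ⟨i, rfl⟩
    have hmi : m i = y • m i + ∑ j, b i j • m j := by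
      rw [← hm, ← add_smul, add_sub_cancel, one_smul]
    rw [hmi]
    exact add_mem (hsmul hy i) (sum_mem fun j _ => hsmul (hb i j) j)
  obtain ⟨r, hrI, hr⟩ := Submodule.exists_sub_one_mem_and_smul_eq_zero_of_fg_of_le_smul I N
    (Submodule.fg_span (Set.finite_range m)) hNI
  have hr1 : constCoeff hv r = 1 := by
    rwa [RingHom.mem_ker, map_sub, map_one, sub_eq_zero] at hrI
  exact ⟨r, isMonic_of_isUnit_constCoeff hv r (hr1 ▸ isUnit_one),
    fun i => hr _ (Submodule.subset_span ⟨i, rfl⟩)⟩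

lemma isMonic_one_sub (hv : Function.Injective v) {y : MonoidAlgebra ℤ A}
    (hy : ∀ g, y.coeff g ≠ 0 → 0 < (v g).toAdd) : IsMonic v (1 - y) := by
  refine isMonic_of_isUnit_constCoeff hv (1 - ⟨y, fun g hg => (hy g hg).le⟩) ?_
  rw [map_sub, map_one, constCoeff_eq_zero hv hy, sub_zero]
  exact isUnit_one

variable (v) in
/-- The error made by truncating a series at level `C`, as a function of `C`. -/
def tail : NovikovModule v →+ nullFamilies v (atTop : Filter ℝ) where
  toFun x := ⟨fun C => x - toNovikov v (truncate C x), sub_truncate_mem_nullFamilies x⟩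
  map_zero' := by
    ext1
    funext C
    simp
  map_add' x y := by
    ext1
    funext C
    simp [add_sub_add_comm]

/-- Evaluation of a null family at a parameter. -/
def evalNull {ι : Type*} {l : Filter ι} (i : ι) :
    nullFamilies v l →ₗ[MonoidAlgebra ℤ A] NovikovModule v :=
  LinearMap.proj i ∘ₗ (nullFamilies v l).subtype

variable {χ : G →* MonoidAlgebra ℤ A}

/-- Truncating the coefficients of a `2`-chain bounding `z` gives boundaries approximating `z`. The
error is the boundary of a single chain with coefficients in the module of null families, which
bounds its support uniformly. -/
lemma exists_null_family_of_chainMap_mem_boundaries {z : G →₀ (X → MonoidAlgebra ℤ A)}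
    (hz : chainMap (toNovikov v) z ∈ boundaries (twistedRep X (NovikovModule v) χ)) :
    ∃ (S : Finset G) (ζ : ℝ → (G →₀ (X → MonoidAlgebra ℤ A))), (∀ C, (ζ C).support ⊆ S) ∧
      (∀ g x, (fun C => toNovikov v (ζ C g x)) ∈ nullFamilies v atTop) ∧
      ∀ C, z - ζ C ∈ boundaries (twistedRep X (MonoidAlgebra ℤ A) χ) := by
  obtain ⟨w, hw⟩ := hz
  let wC (C : ℝ) : G × G →₀ (X → MonoidAlgebra ℤ A) :=
    Finsupp.mapRange.addMonoidHom ((truncate C).compLeft X) w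
  let ζ (C : ℝ) := z - diffTwo (twistedRep X (MonoidAlgebra ℤ A) χ) (wC C)
  let ω := diffTwo (twistedRep X (nullFamilies v (atTop : Filter ℝ)) χ)
    (Finsupp.mapRange.addMonoidHom ((tail v).compLeft X) w)
  have hω (C : ℝ) : chainMap (toNovikov v) (ζ C) =
      chainMap (R := MonoidAlgebra ℤ A) (evalNull C) ω := by
    rw [map_sub, ← hw, ← diffTwo_chainMap, ← diffTwo_chainMap, ← map_sub]
    exact congrArg _ (Finsupp.ext fun _ => rfl)
  have hωζ (g : G) (x : X) (C : ℝ) : toNovikov v (ζ C g x) = (ω g x).1 C :=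
    congr_fun (DFunLike.congr_fun (hω C) g) x
  refine ⟨ω.support, ζ, fun C g hg => ?_, fun g x => ?_, fun C => ?_⟩
  · rw [Finsupp.mem_support_iff] at hg ⊢
    refine fun h => hg (funext fun x => toNovikov_injective (v := v) ?_)
    rw [hωζ, h]
    simp
  · simp only [hωζ]
    exact (ω g x).2
  · rw [sub_sub_cancel]
    exact ⟨_, rfl⟩

lemma exists_mkQ_eq_sum_smul [Finite X] {z : G →₀ (X → MonoidAlgebra ℤ A)}
    (hz : chainMap (toNovikov v) z ∈ boundaries (twistedRep X (NovikovModule v) χ))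
    {ι : Type*} [Fintype ι]
    {q : ι → (G →₀ (X → MonoidAlgebra ℤ A)) ⧸ boundaries (twistedRep X (MonoidAlgebra ℤ A) χ)}
    (hq : Submodule.span (MonoidAlgebra ℤ A) (Set.range q) = ⊤) :
    ∃ a : ι → MonoidAlgebra ℤ A, (∀ i g, (a i).coeff g ≠ 0 → 0 < (v g).toAdd) ∧
      (boundaries (twistedRep X (MonoidAlgebra ℤ A) χ)).mkQ z = ∑ i, a i • q i := by
  classical
  have := Fintype.ofFinite X
  obtain ⟨S, ζ, hS, hζ, hzζ⟩ := exists_null_family_of_chainMap_mem_boundaries hz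
  have hspan (g : G) (x : X) : ∃ c : ι → MonoidAlgebra ℤ A,
      ∑ i, c i • q i = Submodule.Quotient.mk (Finsupp.single g (Pi.single x 1)) :=
    (Submodule.mem_span_range_iff_exists_fun _).1 (hq ▸ Submodule.mem_top)
  choose c hc using hspan
  let a (C : ℝ) (i : ι) : MonoidAlgebra ℤ A := ∑ p ∈ S ×ˢ Finset.univ, c p.1 p.2 i * ζ C p.1 p.2
  have hanull (i : ι) : (fun C => toNovikov v (a C i)) ∈ nullFamilies v atTop := by
    have : (fun C => toNovikov v (a C i)) =
        ∑ p ∈ S ×ˢ Finset.univ, c p.1 p.2 i • fun C => toNovikov v (ζ C p.1 p.2) := by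
      funext C
      simp only [a, ← smul_eq_mul, map_sum, map_smul, Finset.sum_apply, Pi.smul_apply]
    rw [this]
    exact sum_mem fun p _ => Submodule.smul_mem _ _ (hζ p.1 p.2)
  obtain ⟨C, hC⟩ := (eventually_all.2 fun i => hanull i 1).exists
  refine ⟨a C, fun i g hg => zero_lt_one.trans_le (hC i g (by simpa using hg)), ?_⟩
  calc (boundaries (twistedRep X (MonoidAlgebra ℤ A) χ)).mkQ z
      = (boundaries (twistedRep X (MonoidAlgebra ℤ A) χ)).mkQ (ζ C) :=
      (Submodule.Quotient.eq _).2 (hzζ C)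
    _ = ∑ p ∈ S ×ˢ Finset.univ, ζ C p.1 p.2 • ∑ i, c p.1 p.2 i • q i := by
      conv_lhs => rw [eq_sum_smul_single (hS C)]
      simp only [map_sum, map_smul, Submodule.mkQ_apply, hc]
    _ = ∑ i, a C i • q i := by
      simp only [a, Finset.sum_smul, Finset.smul_sum, smul_smul, mul_comm (ζ C _ _)]
      exact Finset.sum_comm

section Equivalence

variable [Group.FG G] [Finite X] {γ : G} {n : ℕ}

/-- The classes `m i` of the cycles obtained by retracting generators of the chains satisfy
`(1 - χ γ ^ n) • m i = ∑ j, a i j • m j` with coefficients of positive order, so that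
Nakayama's lemma applies. -/
lemma exists_isMonic_smul_mem_boundaries (hv : Function.Injective v)
    (hχ : ∀ g, (χ γ ^ n).coeff g ≠ 0 → 0 < (v g).toAdd) (hγ : ∀ x : X, γ ^ n • x = x)
    (h : cycles (twistedRep X (NovikovModule v) χ) ≤
      boundaries (twistedRep X (NovikovModule v) χ)) :
    ∃ s, IsMonic v s ∧ ∀ z ∈ cycles (twistedRep X (MonoidAlgebra ℤ A) χ),
      s • z ∈ boundaries (twistedRep X (MonoidAlgebra ℤ A) χ) := by
  classical
  set D := boundaries (twistedRep X (MonoidAlgebra ℤ A) χ)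
  let r := cycleMap X (MonoidAlgebra ℤ A) χ γ n
  have hr {z} (hz : z ∈ cycles (twistedRep X (MonoidAlgebra ℤ A) χ)) :
      r z = (1 - χ γ ^ n) • z := cycleMap_of_mem_cycles χ γ n hz
  have hrD : D ≤ D.comap r := fun z hz => by
    rw [Submodule.mem_comap, hr (boundaries_le_cycles _ hz)]
    exact D.smul_mem _ hz
  let rbar := D.mapQ D r hrD
  have : Module.Finite (MonoidAlgebra ℤ A) (_ ⧸ D) := finite_chains_quotient_boundaries _
  obtain ⟨N, q, hq⟩ := Module.Finite.exists_fin (R := MonoidAlgebra ℤ A) (M := _ ⧸ D)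
  have happrox (i : Fin N) : ∃ a : Fin N → MonoidAlgebra ℤ A,
      (∀ j g, (a j).coeff g ≠ 0 → 0 < (v g).toAdd) ∧ rbar (q i) = ∑ j, a j • q j ∧
        rbar (rbar (q i)) = (1 - χ γ ^ n) • rbar (q i) := by
    obtain ⟨z, hz⟩ := D.mkQ_surjective (q i)
    have hrz := cycleMap_mem_cycles χ hγ z
    obtain ⟨a, ha, hza⟩ := exists_mkQ_eq_sum_smul (v := v) (h (by
      rw [mem_cycles, diffOne_chainMap, mem_cycles.1 hrz, map_zero])) hq
    rw [← hz]
    exact ⟨a, ha, hza, congrArg D.mkQ (hr hrz)⟩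
  choose a ha hqa hqq using happrox
  obtain ⟨s, hs, hsq⟩ := exists_isMonic_smul_eq_zero hv hχ ha (m := fun i => rbar (q i))
    fun i => by rw [← hqq, hqa, map_sum]; simp only [map_smul]
  refine ⟨s * (1 - χ γ ^ n), (isMonic_mul_iff hv).2 ⟨hs, isMonic_one_sub hv hχ⟩, fun z hz => ?_⟩
  obtain ⟨c, hc⟩ := (Submodule.mem_span_range_iff_exists_fun _).1
    (hq ▸ Submodule.mem_top : D.mkQ z ∈ _)
  have hsz : s • rbar (D.mkQ z) = 0 := by
    rw [← hc, map_sum, Finset.smul_sum]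
    exact Finset.sum_eq_zero fun i _ => by rw [map_smul, smul_comm, hsq, smul_zero]
  rw [mul_smul, ← hr hz]
  exact (Submodule.Quotient.mk_eq_zero D).1 hsz

theorem cycles_novikov_le_boundaries_iff (hv : Function.Injective v)
    (hχ : ∀ g, (χ γ ^ n).coeff g ≠ 0 → 0 < (v g).toAdd) (hγ : ∀ x : X, γ ^ n • x = x) :
    cycles (twistedRep X (NovikovModule v) χ) ≤ boundaries (twistedRep X (NovikovModule v) χ) ↔
      ∃ s, IsMonic v s ∧ ∀ z ∈ cycles (twistedRep X (MonoidAlgebra ℤ A) χ),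
        s • z ∈ boundaries (twistedRep X (MonoidAlgebra ℤ A) χ) := by
  refine ⟨exists_isMonic_smul_mem_boundaries hv hχ hγ, fun ⟨s, hs, hsz⟩ z hz => ?_⟩
  exact mem_boundaries_of_smul_mem χ
    ((isMonic_mul_iff hv).2 ⟨hs, isMonic_one_sub hv hχ⟩).bijective_smul
    (mul_smul_mem_boundaries χ hγ hsz hz)

end Equivalence

end Approximation

/-! ### Decomposition into orbits -/

section Orbits

variable {A B X : Type*} [CommGroup A] [Group B] [MulAction B X] {v : A →* Multiplicative ℝ}
  {w : B →* Multiplicative ℝ} (π : B →* A)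

/-- The orbit map of `(1, j)` for the action of `B` on `A × X`, where `B` acts on `A` through the
homomorphism `π`. -/
def orbitMap (j : X) (b : B) : A × X := (π b, b • j)

variable {π}

lemma orbitMap_injective (hfree : ∀ b (x : X), π b = 1 → b • x = x → b = 1) (j : X) :
    Function.Injective (orbitMap π j) := fun b c h => by
  obtain ⟨hA, hX⟩ := Prod.ext_iff.1 h
  exact inv_mul_eq_one.1 (hfree _ j (by rw [map_mul, map_inv, inv_mul_eq_one]; exact hA)
    (by rw [mul_smul, inv_smul_eq_iff]; exact hX.symm))

lemma orbitMap_mul (j : X) (b c : B) :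
    orbitMap π j (b * c) = (π b * (orbitMap π j c).1, b • (orbitMap π j c).2) :=
  Prod.ext (map_mul π b c) (mul_smul b c j)

lemma mem_range_orbitMap_iff {j y : X} {b : B} :
    (π b, y) ∈ Set.range (orbitMap π j) ↔ b⁻¹ • y ∈ MulAction.orbit π.ker j := by
  constructor
  · rintro ⟨c, hc⟩
    obtain ⟨hA, hX⟩ := Prod.ext_iff.1 hc
    refine ⟨⟨b⁻¹ * c, ?_⟩, ?_⟩
    · rw [MonoidHom.mem_ker, map_mul, map_inv, inv_mul_eq_one]
      exact hA.symm
    · change (b⁻¹ * c) • j = b⁻¹ • y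
      rw [mul_smul]
      exact congrArg (b⁻¹ • ·) hX
  · rintro ⟨c, hc⟩
    refine ⟨b * c, Prod.ext ?_ ?_⟩
    · rw [orbitMap, map_mul, c.2, mul_one]
    · rw [orbitMap, mul_smul, smul_eq_iff_eq_inv_smul]
      exact hc

variable (hw : ∀ b, w b = v (π b)) (hfree : ∀ b (x : X), π b = 1 → b • x = x → b = 1)

/-- Extension by zero along an orbit map. -/
def extendOrbit (j : X) : novikov w →+ (X → NovikovModule v) where
  toFun x y := novMk (fun a => Function.extend (orbitMap π j) x.1 0 (a, y)) fun C => by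
    refine ((x.2 C).image π).subset ?_
    rintro a ⟨ha, hC⟩
    obtain ⟨b, hb⟩ : (a, y) ∈ Set.range (orbitMap π j) := by
      by_contra h
      exact ha (Function.extend_apply' _ _ _ h)
    rw [← hb, (orbitMap_injective hfree j).extend_apply] at ha
    obtain ⟨rfl, -⟩ := Prod.ext_iff.1 hb
    exact ⟨b, ⟨ha, (hw b).symm ▸ hC⟩, rfl⟩
  map_zero' := by
    ext y a
    exact congr_fun (Function.extend_zero (orbitMap π j)) (a, y)
  map_add' x x' := by
    ext y a
    have := Function.extend_add (orbitMap π j) x.1 x'.1 0 0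
    rw [add_zero] at this
    exact congr_fun this (a, y)

lemma novCoeff_extendOrbit (j : X) (x : novikov w) (y : X) (a : A) :
    novCoeff (extendOrbit hw hfree j x y) a = Function.extend (orbitMap π j) x.1 0 (a, y) := rfl

/-- Restriction to an orbit. -/
def restrictOrbit [Finite X] (j : X) : (X → NovikovModule v) →+ novikov w where
  toFun f := ⟨fun b => novCoeff (f (orbitMap π j b).2) (orbitMap π j b).1, fun C => by
    have hfin : (⋃ y, (·, y) '' {a | novCoeff (f y) a ≠ 0 ∧ (v a).toAdd ≤ C}).Finite :=
      Set.finite_iUnion fun y => (finite_novCoeff (f y) C).image _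
    refine (hfin.preimage (orbitMap_injective hfree j).injOn).subset fun b ⟨hb, hC⟩ => ?_
    exact Set.mem_iUnion.2 ⟨_, _, ⟨hb, hw b ▸ hC⟩, rfl⟩⟩
  map_zero' := rfl
  map_add' _ _ := rfl

lemma restrictOrbit_extendOrbit [Finite X] (j : X) (x : novikov w) :
    restrictOrbit hw hfree j (extendOrbit hw hfree j x) = x :=
  Subtype.ext (funext fun b => (orbitMap_injective hfree j).extend_apply x.1 0 b)

lemma sum_extendOrbit_restrictOrbit [Finite X] [Fintype (MulAction.orbitRel.Quotient π.ker X)]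
    (hπ : Function.Surjective π) (f : X → NovikovModule v) :
    ∑ o : MulAction.orbitRel.Quotient π.ker X,
      extendOrbit hw hfree o.out (restrictOrbit hw hfree o.out f) = f := by
  ext y a
  obtain ⟨b, rfl⟩ := hπ a
  let o₀ : MulAction.orbitRel.Quotient π.ker X := ⟦b⁻¹ • y⟧
  have hmem (o : MulAction.orbitRel.Quotient π.ker X) :
      (π b, y) ∈ Set.range (orbitMap π o.out) ↔ o₀ = o := by
    rw [mem_range_orbitMap_iff, ← MulAction.orbitRel_apply, ← Quotient.eq, Quotient.out_eq]
  rw [Finset.sum_apply, map_sum, Finset.sum_apply, Finset.sum_eq_single o₀]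
  · obtain ⟨c, hc⟩ := (hmem o₀).2 rfl
    rw [novCoeff_extendOrbit, ← hc, (orbitMap_injective hfree _).extend_apply]
    change novCoeff (f (orbitMap π _ c).2) (orbitMap π _ c).1 = _
    rw [hc]
  · intro o _ ho
    exact Function.extend_apply' _ _ _ fun h => ho ((hmem o).1 h).symm
  · simp

end Orbits

section OrbitHomology

variable {A B X G : Type} [CommGroup A] [Group B] [MulAction B X] {v : A →* Multiplicative ℝ}
  {w : B →* Multiplicative ℝ} {π : B →* A} (hw : ∀ b, w b = v (π b))
  (hfree : ∀ b (x : X), π b = 1 → b • x = x → b = 1)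
  [Group G] [MulAction G X] {θ : G →* B} (hθ : ∀ g (x : X), θ g • x = g • x)

include hθ in
lemma novCoeff_twistedRep (g : G) (f : X → NovikovModule v) (x : X) (a : A) :
    novCoeff (twistedRep X (NovikovModule v) ((MonoidAlgebra.of ℤ A).comp (π.comp θ)) g f x) a =
      novCoeff (f ((θ g)⁻¹ • x)) ((π (θ g))⁻¹ * a) := by
  rw [twistedRep_apply, ← hθ, map_inv]
  exact (novCoeff_single_smul _ _ _ _).trans (one_mul _)

include hθ in
lemma extendOrbit_novikovRep (j : X) (g : G) (x : novikov w) :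
    extendOrbit hw hfree j ((novikovRep w).comp θ g x) =
      twistedRep X (NovikovModule v) ((MonoidAlgebra.of ℤ A).comp (π.comp θ)) g
        (extendOrbit hw hfree j x) := by
  ext y a
  rw [novCoeff_twistedRep hθ, novCoeff_extendOrbit, novCoeff_extendOrbit]
  by_cases h : ∃ b, orbitMap π j b = (a, y)
  · obtain ⟨b, hb⟩ := h
    have hb' : orbitMap π j ((θ g)⁻¹ * b) = ((π (θ g))⁻¹ * a, (θ g)⁻¹ • y) := by
      rw [orbitMap_mul, hb, map_inv]
    rw [← hb, ← hb', (orbitMap_injective hfree j).extend_apply,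
      (orbitMap_injective hfree j).extend_apply]
    rfl
  · rw [Function.extend_apply' _ _ _ h, Function.extend_apply']
    · rfl
    · rintro ⟨b, hb⟩
      exact h ⟨θ g * b, by rw [orbitMap_mul, hb, mul_inv_cancel_left, smul_inv_smul]⟩

include hθ in
lemma restrictOrbit_twistedRep [Finite X] (j : X) (g : G) (f : X → NovikovModule v) :
    restrictOrbit hw hfree j
        (twistedRep X (NovikovModule v) ((MonoidAlgebra.of ℤ A).comp (π.comp θ)) g f) =
      (novikovRep w).comp θ g (restrictOrbit hw hfree j f) := by
  refine Subtype.ext (funext fun b => ?_)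
  have hb : orbitMap π j ((θ g)⁻¹ * b) =
      ((π (θ g))⁻¹ * (orbitMap π j b).1, (θ g)⁻¹ • (orbitMap π j b).2) := by
    rw [orbitMap_mul, map_inv]
  change _ = novCoeff (f (orbitMap π j ((θ g)⁻¹ * b)).2) (orbitMap π j ((θ g)⁻¹ * b)).1
  rw [hb]
  exact novCoeff_twistedRep hθ g f _ _

include hw hfree hθ in
theorem cycles_novikovRep_le_boundaries_iff [Finite X] [Nonempty X] (hπ : Function.Surjective π) :
    cycles ((novikovRep w).comp θ) ≤ boundaries ((novikovRep w).comp θ) ↔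
      cycles (twistedRep X (NovikovModule v) ((MonoidAlgebra.of ℤ A).comp (π.comp θ))) ≤
        boundaries (twistedRep X (NovikovModule v) ((MonoidAlgebra.of ℤ A).comp (π.comp θ))) := by
  constructor <;> intro h z hz
  · have := Fintype.ofFinite (MulAction.orbitRel.Quotient π.ker X)
    have hdecomp : z = ∑ o : MulAction.orbitRel.Quotient π.ker X, Finsupp.mapRange.addMonoidHom
        (extendOrbit hw hfree o.out)
        (Finsupp.mapRange.addMonoidHom (restrictOrbit hw hfree o.out) z) := by
      ext g : 1
      rw [Finsupp.finsetSum_apply]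
      exact (sum_extendOrbit_restrictOrbit hw hfree hπ (z g)).symm
    rw [hdecomp]
    exact sum_mem fun o _ => mapRange_mem_boundaries _ (extendOrbit_novikovRep hw hfree hθ _)
      (h (mapRange_mem_cycles _ (restrictOrbit_twistedRep hw hfree hθ _) hz))
  · let j : X := Classical.arbitrary X
    have hretract : z = Finsupp.mapRange.addMonoidHom (restrictOrbit hw hfree j)
        (Finsupp.mapRange.addMonoidHom (extendOrbit hw hfree j) z) := by
      ext g : 1
      exact (restrictOrbit_extendOrbit hw hfree j (z g)).symm
    rw [hretract]
    exact mapRange_mem_boundaries _ (restrictOrbit_twistedRep hw hfree hθ j)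
      (h (mapRange_mem_cycles _ (extendOrbit_novikovRep hw hfree hθ j) hz))

end OrbitHomology

/-! ### The twisted Alexander polynomial -/

section AlexanderPolynomial

lemma exists_toAdd_map_pos {G : Type*} [Group G] {u : G →* Multiplicative ℝ} (hu : u ≠ 1) :
    ∃ γ : G, 0 < (u γ).toAdd := by
  obtain ⟨g, hg⟩ : ∃ g, u g ≠ 1 := by
    by_contra! h
    exact hu (MonoidHom.ext h)
  rcases lt_trichotomy (u g).toAdd 0 with h | h | h
  · exact ⟨g⁻¹, by rwa [map_inv, toAdd_inv, Left.neg_pos_iff]⟩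
  · exact absurd (Multiplicative.toAdd.injective h) hg
  · exact ⟨g, h⟩

variable {G : Type} [Group G] (H : Subgroup G) (u : G →* Multiplicative ℝ)

/-- The `G`-module `R̂^(G/H)`, where `R̂` is the Novikov completion of `R = ℤ[G / ker u]`. -/
abbrev completedAlexanderRep :
    Representation (QuotientRing u) G (G ⧸ H → NovikovModule (QuotientGroup.kerLift u)) :=
  twistedRep (G ⧸ H) (NovikovModule (QuotientGroup.kerLift u))
    ((MonoidAlgebra.of ℤ (G ⧸ u.ker)).comp (QuotientGroup.mk' u.ker))

theorem exists_isTwistedAlexanderPolynomial [Group.FG G] [H.FiniteIndex] :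
    ∃ Δ, IsTwistedAlexanderPolynomial H u Δ := by
  have hv := QuotientGroup.kerLift_injective u
  have := uniqueFactorizationMonoid_of_injective ℤ hv
  have : IsNoetherianRing (QuotientRing u) := Algebra.FiniteType.isNoetherianRing ℤ _
  have : Module.Finite (QuotientRing u) (alexanderModule H u) :=
    finite_homologyOne (alexanderRep H u)
  exact exists_isOrder

variable [H.Normal]

lemma subsingleton_abelianizedNovikovHomology_iff [H.FiniteIndex] :
    Subsingleton (abelianizedNovikovHomology H u) ↔
      cycles (completedAlexanderRep H u) ≤ boundaries (completedAlexanderRep H u) := by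
  let π : G ⧸ (H ⊓ u.ker) →* G ⧸ u.ker :=
    QuotientGroup.map _ _ (MonoidHom.id G) inf_le_right
  let _ : MulAction (G ⧸ (H ⊓ u.ker)) (G ⧸ H) :=
    MulAction.compHom _ (QuotientGroup.map _ _ (MonoidHom.id G) inf_le_left)
  have hw (b) : inducedHom H u b = QuotientGroup.kerLift u (π b) := by
    obtain ⟨g, rfl⟩ := QuotientGroup.mk_surjective b
    rfl
  have hfree (b) (x : G ⧸ H) (hb : π b = 1) (hx : b • x = x) : b = 1 := by
    obtain ⟨g, rfl⟩ := QuotientGroup.mk_surjective b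
    exact (QuotientGroup.eq_one_iff g).2
      ⟨(QuotientGroup.eq_one_iff g).1 (mul_eq_right.1 hx), (QuotientGroup.eq_one_iff g).1 hb⟩
  have hπ : Function.Surjective π := fun a => by
    obtain ⟨g, rfl⟩ := QuotientGroup.mk_surjective a
    exact ⟨(g : G ⧸ (H ⊓ u.ker)), rfl⟩
  have hθ (g : G) (x : G ⧸ H) : QuotientGroup.mk' (H ⊓ u.ker) g • x = g • x := by
    obtain ⟨y, rfl⟩ := QuotientGroup.mk_surjective x
    rfl
  rw [subsingleton_homologyOne_iff]
  exact cycles_novikovRep_le_boundaries_iff hw hfree hθ hπ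

lemma pow_index_smul (γ : G) (x : G ⧸ H) : γ ^ H.index • x = x := by
  obtain ⟨y, rfl⟩ := QuotientGroup.mk_surjective x
  change ((γ ^ H.index * y : G) : G ⧸ H) = y
  rw [QuotientGroup.mk_mul, (QuotientGroup.eq_one_iff _).2 (H.pow_index_mem γ), one_mul]

variable {u} in
lemma subsingleton_abelianizedNovikovHomology_iff_exists_isMonic [Group.FG G] [H.FiniteIndex]
    (hu : u ≠ 1) :
    Subsingleton (abelianizedNovikovHomology H u) ↔
      ∃ s ∈ Module.annihilator (QuotientRing u) (alexanderModule H u),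
        IsMonic (QuotientGroup.kerLift u) s := by
  obtain ⟨γ, hγ⟩ := exists_toAdd_map_pos hu
  have hpos (g) (hg : ((MonoidAlgebra.of ℤ (G ⧸ u.ker) γ) ^ H.index).coeff g ≠ 0) :
      0 < (QuotientGroup.kerLift u g).toAdd := by
    rw [← map_pow, MonoidAlgebra.of_apply] at hg
    rw [eq_of_coeff_single_ne_zero hg, map_pow]
    exact nsmul_pos hγ (Subgroup.FiniteIndex.index_ne_zero (H := H))
  rw [subsingleton_abelianizedNovikovHomology_iff, completedAlexanderRep,
    cycles_novikov_le_boundaries_iff (γ := γ) (QuotientGroup.kerLift_injective u) hpos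
      (pow_index_smul H γ)]
  simp only [alexanderModule, mem_annihilator_homologyOne_iff, and_comm]
  rfl

end AlexanderPolynomial

end TwistedAlexander

end

theorem mainTheorem5 {G : Type} [Group G] [Group.FG G]
    (u : G →* Multiplicative ℝ) (hu : u ≠ 1) (H : Subgroup G) [H.Normal] [H.FiniteIndex] :
    (∃ Δ, TwistedAlexander.IsTwistedAlexanderPolynomial H u Δ) ∧
    ∀ Δ, TwistedAlexander.IsTwistedAlexanderPolynomial H u Δ →
      (TwistedAlexander.IsMonic (QuotientGroup.kerLift u) Δ ↔
        Subsingleton (TwistedAlexander.abelianizedNovikovHomology H u)) :=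
  ⟨TwistedAlexander.exists_isTwistedAlexanderPolynomial H u, fun _ hΔ =>
    (hΔ.isMonic_iff (QuotientGroup.kerLift_injective u)).trans
      (TwistedAlexander.subsingleton_abelianizedNovikovHomology_iff_exists_isMonic H hu).symm⟩
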